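/- Let $n\ge 1$, let $\mu\ge 0$ and $\nu^2\ge 0$ be constants with $\delta:=(\mu-1)^2-4\nu^2\ge 0$, and put $\sigma:=\mu+1-\sqrt{\delta}$ if $\delta\in[0,1)$ and $\sigma:=\mu$ if $\delta\ge 1$. For $m\geq 1$ let $p_{\mathrm{Gla}}(m):=\frac{m+1}{m-1}$ if $m>1$ and $p_{\mathrm{Gla}}(1):=\infty$. Let $u_0,u_1:\mathbb{R}^n\to\mathbb{R}$, not both identically zero, be supported in the ball $B_R$ of radius $R>0$ centred at the origin, and assume that $u_0\ge 0$ and $u_1\ge 0$ if $\delta\ge 1$, and that $u_0=0$ and $u_1\ge 0$ if $\delta\in[0,1)$. Let $1<p\le p_{\mathrm{Gla}}(n+\sigma)$, with $p<\infty$. For $\varepsilon>0$ consider the Cauchy problem $$u_{tt}-\Delta u+\frac{\mu}{1+t}u_t+\frac{\nu^2}{(1+t)^2}u=|u_t|^p\quad (t>0,\ x\in\mathbb{R}^n),\qquad u(0,x)=\varepsilon u_0(x),\quad u_t(0,x)=\varepsilon u_1(x).$$ A solution on $[0,T)$, $0<T\le\infty$, is a function $u\in C^1([0,T)\times\mathbb{R}^n)\cap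 C^2((0,T)\times\mathbb{R}^n)$ that satisfies the equation at every point of $(0,T)\times\mathbb{R}^n$ and both initial conditions; its lifespan $T(\varepsilon)$ is the supremum of all $T'\ge T$ such that $u$ extends to a solution on $[0,T')$, and $u$ blows up in finite time if $T(\varepsilon)<\infty$. Then there are $\varepsilon_0>0$ and $C>0$, depending only on $n,p,\mu,\nu^2,u_0,u_1,R$, such that for every $\varepsilon\in(0,\varepsilon_0]$ every local in time solution $u$ of the Cauchy problem blows up in finite time, and its lifespan satisfies $$T(\varepsilon)\le\begin{cases} C\,\varepsilon^{-\left(\frac{1}{p-1}-\frac{n+\sigma-1}{2}\right)^{-1}} & \text{if } 1<p<p_{\mathrm{Gla}}(n+\sigma),\\[4pt] \exp\!\big(C\,\varepsilon^{-(p-1)}\big) & \text{if } p=p_{\mathrm{Gla}}(n+\sigma).\end{cases}$$ -/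

import Mathlib

open Set
open scoped Laplacian

noncomputable section

namespace ScaleInvariantWave

/-- The discriminant `δ = (μ - 1)² - 4 ν²`. -/
def delta (μ ν : ℝ) : ℝ := (μ - 1) ^ 2 - 4 * ν ^ 2

/-- The shift `σ`: `μ + 1 - √δ` if `δ < 1`, and `μ` if `δ ≥ 1`. -/
def sigma (μ ν : ℝ) : ℝ :=
  if delta μ ν < 1 then μ + 1 - √(delta μ ν) else μ

/-- The Glassey exponent `(m + 1) / (m - 1)` for `m > 1`, with the usual convention that it is
`∞` for `m ≤ 1`. -/
def glassey (m : ℝ) : EReal :=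
  if m ≤ 1 then ⊤ else (((m + 1) / (m - 1) : ℝ) : EReal)

/-- The time interval `[0, T)`, where `T = ∞` is allowed. -/
def timeIco (T : EReal) : Set ℝ := {t | 0 ≤ t ∧ (t : EReal) < T}

/-- The time interval `(0, T)`, where `T = ∞` is allowed. -/
def timeIoo (T : EReal) : Set ℝ := {t | 0 < t ∧ (t : EReal) < T}

/-- `u` is a (classical) solution on `[0, T) × ℝⁿ` of
`u_tt - Δu + μ / (1 + t) u_t + ν² / (1 + t)² u = |u_t|^p`, `u(0) = ε u₀`, `u_t(0) = ε u₁`: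
it is `C¹` up to the initial time, `C²` for positive times, and satisfies the equation at
every point with `0 < t < T`. -/
structure IsSolution {n : ℕ} (μ ν p ε : ℝ) (u₀ u₁ : EuclideanSpace ℝ (Fin n) → ℝ)
    (T : EReal) (u : ℝ → EuclideanSpace ℝ (Fin n) → ℝ) : Prop where
  pos : 0 < T
  contDiffOn_one : ContDiffOn ℝ 1 (fun q : ℝ × EuclideanSpace ℝ (Fin n) => u q.1 q.2)
    (timeIco T ×ˢ univ)
  contDiffOn_two : ContDiffOn ℝ 2 (fun q : ℝ × EuclideanSpace ℝ (Fin n) => u q.1 q.2)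
    (timeIoo T ×ˢ univ)
  equation : ∀ t ∈ timeIoo T, ∀ x : EuclideanSpace ℝ (Fin n),
    deriv (deriv fun s => u s x) t - Δ (u t) x
      + μ / (1 + t) * deriv (fun s => u s x) t + ν ^ 2 / (1 + t) ^ 2 * u t x
      = |deriv (fun s => u s x) t| ^ p
  initial_value : ∀ x, u 0 x = ε * u₀ x
  initial_velocity : ∀ x, HasDerivWithinAt (fun s => u s x) (ε * u₁ x) (Ici 0) 0

/-- The lifespan of a solution `u` given on `[0, T)`: the supremum of all `T' ≥ T` such that `u`
extends to a solution on `[0, T')`. -/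
def lifespan {n : ℕ} (μ ν p ε : ℝ) (u₀ u₁ : EuclideanSpace ℝ (Fin n) → ℝ)
    (T : EReal) (u : ℝ → EuclideanSpace ℝ (Fin n) → ℝ) : EReal :=
  sSup {T' : EReal | T ≤ T' ∧ ∃ v : ℝ → EuclideanSpace ℝ (Fin n) → ℝ,
    IsSolution μ ν p ε u₀ u₁ T' v ∧ ∀ t ∈ timeIco T, v t = u t}

/-- The solution `u` blows up in finite time: its lifespan is finite. -/
def BlowsUpInFiniteTime {n : ℕ} (μ ν p ε : ℝ) (u₀ u₁ : EuclideanSpace ℝ (Fin n) → ℝ)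
    (T : EReal) (u : ℝ → EuclideanSpace ℝ (Fin n) → ℝ) : Prop :=
  lifespan μ ν p ε u₀ u₁ T u < ⊤

end ScaleInvariantWave

end

open MeasureTheory Topology

noncomputable section

namespace ScaleInvariantWave

/-! ### Scalar differential inequalities -/

/-! Test the equation against ω(x) = e^{x_i}, which satisfies Δω = ω, and put W = ∫ u ω, V = W' = ∫
u_t ω. Finite speed of propagation (`IsSolution.eq_zero_of_lt_norm`, a weighted energy estimate in
light cones) keeps these integrals finite, and W'' + μ/(1+t) W' + (ν²/(1+t)² - 1) W = N with N = ∫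
|u_t|^p ω ≥ 0. The Liouville transform w = (1+t)^{μ/2} W removes the damping: w'' = (1 + κ/(1+t)²) w
+ (1+t)^{μ/2} N with κ = (δ-1)/4, and δ ≥ 0 says exactly that κ ≥ -1/4.

Such a w grows at least like e^t. `inverse_square_equation_growth` and `damped_equation_growth`
quantify this by a functional G, comparable to e^{-t}(w + w'): it is nondecreasing, starts at size
ε, satisfies G' ≥ c e^{-t} (1+t)^{μ/2} N, and for large t is at most 8 e^{-t} (1+t)^{μ/2} V. Since
u_t(t) lives in the ball of radius R + t, where ω has mass at most K e^t (1+t)^{(n-1)/2}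
(`exists_setIntegral_expWeight_le`), Jensen's inequality (`weightedAverage_rpow_le`) bounds N below
by V^p over the (p-1)-st power of that mass. All exponentials cancel, leaving G' ≥ k G^p
(1+t)^{-(p-1)(n-1+μ)/2}.

As σ ≥ μ, the decay exponent may be enlarged to θ = (p-1)(n-1+σ)/2. Integrating from G of size ε
bounds ∫ (1+t)^{-θ} dt over the existence interval by a multiple of ε^{1-p}
(`exists_existence_time_bound`). This integral grows like a power when θ < 1 and like a logarithm
when θ = 1, the subcritical and the critical case. The regimes δ ≥ 1 and δ < 1 need no separate
treatment: only nonnegative, nontrivial data matter. -/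

lemma monotoneOn_Icc_of_hasDerivAt_nonneg {a b : ℝ} {f f' : ℝ → ℝ}
    (hc : ContinuousOn f (Icc a b)) (hd : ∀ t ∈ Ioo a b, HasDerivAt f (f' t) t)
    (hn : ∀ t ∈ Ioo a b, 0 ≤ f' t) : MonotoneOn f (Icc a b) := by
  refine monotoneOn_of_hasDerivWithinAt_nonneg (convex_Icc a b) hc (f' := f') ?_ ?_
  · intro t ht
    rw [interior_Icc] at ht
    exact (hd t ht).hasDerivWithinAt
  · intro t ht
    rw [interior_Icc] at ht
    exact hn t ht

/-- Up to the first zero w is positive, hence w'' ≥ 0 there, hence w' stays nonnegative and w cannot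
have decreased from its positive initial value. -/
lemma pos_of_second_deriv_ge {b : ℝ} {w w' w'' q : ℝ → ℝ}
    (hw : ContinuousOn w (Icc 0 b)) (hw' : ContinuousOn w' (Icc 0 b))
    (hd : ∀ t ∈ Ioo 0 b, HasDerivAt w (w' t) t) (hd' : ∀ t ∈ Ioo 0 b, HasDerivAt w' (w'' t) t)
    (hq : ∀ t ∈ Ioo 0 b, 0 ≤ q t) (hge : ∀ t ∈ Ioo 0 b, q t * w t ≤ w'' t)
    (h0 : 0 < w 0) (h0' : 0 ≤ w' 0) : ∀ t ∈ Icc 0 b, 0 < w t := by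
  by_contra! hcon
  obtain ⟨t, ht, hwt⟩ := hcon
  -- The infimum of this closed set is the first time at which w fails to be positive.
  set Z := Icc 0 b ∩ w ⁻¹' Iic 0 with hZ
  have hZc : IsClosed Z := hw.preimage_isClosed_of_isClosed isClosed_Icc isClosed_Iic
  have hZb : BddBelow Z := ⟨0, fun s hs => hs.1.1⟩
  have hmem : sInf Z ∈ Z := hZc.csInf_mem ⟨t, ht, hwt⟩ hZb
  set s := sInf Z
  have hpos : ∀ r ∈ Ioo 0 s, 0 < w r := by
    intro r hr
    by_contra! h
    exact absurd (csInf_le hZb (⟨⟨hr.1.le, hr.2.le.trans hmem.1.2⟩, h⟩ : r ∈ Z)) (not_le.2 hr.2)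
  have hsub : Icc 0 s ⊆ Icc 0 b := Icc_subset_Icc le_rfl hmem.1.2
  have hsub' : Ioo 0 s ⊆ Ioo 0 b := Ioo_subset_Ioo le_rfl hmem.1.2
  have hmono' := monotoneOn_Icc_of_hasDerivAt_nonneg (hw'.mono hsub)
    (fun r hr => hd' r (hsub' hr))
    (fun r hr => (mul_nonneg (hq r (hsub' hr)) (hpos r hr).le).trans (hge r (hsub' hr)))
  have hs0 : (0 : ℝ) ≤ s := hmem.1.1
  have hmono := monotoneOn_Icc_of_hasDerivAt_nonneg (hw.mono hsub)
    (fun r hr => hd r (hsub' hr))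
    (fun r hr => h0'.trans (hmono' ⟨le_rfl, hs0⟩ ⟨hr.1.le, hr.2.le⟩ hr.1.le))
  have h1 := hmono ⟨le_rfl, hs0⟩ ⟨hs0, le_rfl⟩ hs0
  have h2 : w s ≤ 0 := hmem.2
  linarith

/-- Adding η e^{Lt} makes the initial value strictly positive, and L² ≥ q makes the perturbation
itself satisfy the differential inequality; then η is arbitrary. -/
lemma nonneg_of_second_deriv_ge {b L : ℝ} {w w' w'' q : ℝ → ℝ}
    (hw : ContinuousOn w (Icc 0 b)) (hw' : ContinuousOn w' (Icc 0 b))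
    (hd : ∀ t ∈ Ioo 0 b, HasDerivAt w (w' t) t) (hd' : ∀ t ∈ Ioo 0 b, HasDerivAt w' (w'' t) t)
    (hq : ∀ t ∈ Ioo 0 b, 0 ≤ q t) (hqL : ∀ t ∈ Ioo 0 b, q t ≤ L ^ 2) (hL : 0 ≤ L)
    (hge : ∀ t ∈ Ioo 0 b, q t * w t ≤ w'' t) (h0 : 0 ≤ w 0) (h0' : 0 ≤ w' 0) :
    ∀ t ∈ Icc 0 b, 0 ≤ w t := by
  intro t ht
  have key : ∀ η > 0, 0 < w t + η * Real.exp (L * t) := by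
    intro η hη
    have hexp : ∀ r : ℝ, HasDerivAt (fun r => Real.exp (L * r)) (L * Real.exp (L * r)) r := by
      intro r
      have := ((hasDerivAt_id r).const_mul L).exp
      simpa [mul_comm] using this
    refine pos_of_second_deriv_ge (w := fun t => w t + η * Real.exp (L * t))
      (w' := fun t => w' t + η * (L * Real.exp (L * t)))
      (w'' := fun t => w'' t + η * (L * (L * Real.exp (L * t)))) (q := q)
      (hw.add (by fun_prop)) (hw'.add (by fun_prop))
      (fun r hr => (hd r hr).add ((hexp r).const_mul η))
      (fun r hr => (hd' r hr).add (((hexp r).const_mul L).const_mul η)) hq ?_ ?_ ?_ t ht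
    · intro r hr
      have h1 := hge r hr
      have h2 : q r * (η * Real.exp (L * r)) ≤ L ^ 2 * (η * Real.exp (L * r)) :=
        mul_le_mul_of_nonneg_right (hqL r hr) (by positivity)
      nlinarith
    · positivity
    · positivity
  by_contra! hneg
  -- This η makes the perturbed function vanish at t, contradicting its positivity.
  have := key (-w t / Real.exp (L * t)) (div_pos (by linarith) (Real.exp_pos _))
  rw [div_mul_cancel₀ _ (Real.exp_pos _).ne'] at this
  linarith

/-- The weighted combination `e^{-t - 1/(4(1+t))} (w + w')`. -/
def growth (w w' : ℝ → ℝ) (t : ℝ) : ℝ := Real.exp (-t - 1 / (4 * (1 + t))) * (w t + w' t)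

section

variable {b κ : ℝ} {w w' f : ℝ → ℝ}

/-- Because (1+t)² ≥ 1, the bound κ ≥ -1/4 keeps the coefficient of w nonnegative, so w stays
nonnegative; then w'' ≥ 0 and w' is nondecreasing. -/
lemma nonneg_of_inverse_square_equation (hκ : -(1 / 4) ≤ κ)
    (hw : ContinuousOn w (Icc 0 b)) (hw' : ContinuousOn w' (Icc 0 b))
    (hd : ∀ t ∈ Ioo 0 b, HasDerivAt w (w' t) t)
    (hd' : ∀ t ∈ Ioo 0 b, HasDerivAt w' ((1 + κ / (1 + t) ^ 2) * w t + f t) t)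
    (hf : ∀ t ∈ Ioo 0 b, 0 ≤ f t) (h0 : 0 ≤ w 0) (h0' : 0 ≤ w' 0) :
    ∀ t ∈ Icc 0 b, 0 ≤ w t ∧ 0 ≤ w' t := by
  have hsq : ∀ t ∈ Ioo 0 b, (1 : ℝ) ≤ (1 + t) ^ 2 := fun t ht => by nlinarith [ht.1]
  have hq : ∀ t ∈ Ioo 0 b, 0 ≤ 1 + κ / (1 + t) ^ 2 := by
    intro t ht
    have h1 := hsq t ht
    have : 1 + κ / (1 + t) ^ 2 = ((1 + t) ^ 2 + κ) / (1 + t) ^ 2 := by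
      rw [add_div, div_self (by positivity)]
    rw [this]
    apply div_nonneg <;> linarith
  have hnn : ∀ t ∈ Icc 0 b, 0 ≤ w t := by
    refine nonneg_of_second_deriv_ge (L := 1 + |κ|) hw hw' hd hd' hq ?_ (by positivity) ?_ h0 h0'
    · intro t ht
      have h1 := hsq t ht
      have h2 : κ / (1 + t) ^ 2 ≤ |κ| := by
        rw [div_le_iff₀ (by linarith)]
        nlinarith [le_abs_self κ, abs_nonneg κ]
      nlinarith [abs_nonneg κ]
    · intro t ht
      linarith [hf t ht]
  have hmono := monotoneOn_Icc_of_hasDerivAt_nonneg hw' hd' fun t ht =>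
    add_nonneg (mul_nonneg (hq t ht) (hnn t ⟨ht.1.le, ht.2.le⟩)) (hf t ht)
  exact fun t ht => ⟨hnn t ht, h0'.trans (hmono ⟨le_rfl, ht.1.trans ht.2⟩ ht ht.1)⟩

lemma hasDerivAt_growth {t a : ℝ} (ht : 0 < t) (hd : HasDerivAt w (w' t) t)
    (hd' : HasDerivAt w' a t) :
    HasDerivAt (growth w w') (Real.exp (-t - 1 / (4 * (1 + t))) *
      ((-1 + 1 / (4 * (1 + t) ^ 2)) * (w t + w' t) + (w' t + a))) t := by
  have h1 : HasDerivAt (fun t : ℝ => -t - 1 / (4 * (1 + t))) (-1 + 1 / (4 * (1 + t) ^ 2)) t := by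
    have h2 : HasDerivAt (fun t : ℝ => 4 * (1 + t)) 4 t := by
      simpa using ((hasDerivAt_id t).const_add 1).const_mul 4
    have h3 := (hasDerivAt_id t).neg.sub ((hasDerivAt_const t (1 : ℝ)).div h2 (by positivity))
    refine h3.congr_deriv ?_
    field_simp
    ring
  refine (h1.exp.mul (hd.add hd')).congr_deriv ?_
  simp only [Pi.add_apply]
  ring

lemma continuousOn_growth (hw : ContinuousOn w (Icc 0 b)) (hw' : ContinuousOn w' (Icc 0 b)) :
    ContinuousOn (growth w w') (Icc 0 b) := by
  refine ContinuousOn.mul (ContinuousOn.rexp ?_) (hw.add hw')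
  refine continuousOn_id.neg.sub (continuousOn_const.div (by fun_prop) ?_)
  intro t ht
  have := ht.1
  positivity

/-- A solution of `w'' = (1 + κ / (1 + t)²) w + f` with `κ ≥ -1/4` and nonnegative data grows at
least like `e^t`, both in `w' + w` and in `w' - w / 8`. -/
lemma inverse_square_equation_growth (hκ : -(1 / 4) ≤ κ)
    (hw : ContinuousOn w (Icc 0 b)) (hw' : ContinuousOn w' (Icc 0 b))
    (hd : ∀ t ∈ Ioo 0 b, HasDerivAt w (w' t) t)
    (hd' : ∀ t ∈ Ioo 0 b, HasDerivAt w' ((1 + κ / (1 + t) ^ 2) * w t + f t) t)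
    (hf : ∀ t ∈ Ioo 0 b, 0 ≤ f t) (h0 : 0 ≤ w 0) (h0' : 0 ≤ w' 0) :
    (∃ G' : ℝ → ℝ, ∀ t ∈ Ioo 0 b, HasDerivAt (growth w w') (G' t) t ∧
      Real.exp (-(1 / 4)) * Real.exp (-t) * f t ≤ G' t) ∧
    ∀ t ∈ Icc 0 b, 1 ≤ t → Real.exp t * growth w w' t ≤ 8 * (w' t - w t / 8) := by
  have hnn := nonneg_of_inverse_square_equation hκ hw hw' hd hd' hf h0 h0'
  have hκt : ∀ t ∈ Ioo 0 b, -(1 / 4) * (1 / (1 + t) ^ 2) ≤ κ / (1 + t) ^ 2 := by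
    intro t ht
    rw [div_eq_mul_one_div κ]
    exact mul_le_mul_of_nonneg_right hκ (by positivity)
  have hinv : ∀ t ∈ Ioo 0 b, 1 / (1 + t) ^ 2 ≤ (1 : ℝ) := by
    intro t ht
    rw [div_le_one (by nlinarith [ht.1])]
    nlinarith [ht.1]
  -- With s = 1/(1+t)², the bracket equals (s/4) w' + (1/4 + κ) s w + f. The correction -1/(4(1+t))
  -- in the exponent of `growth` is there to produce the s/4 that offsets a negative κ.
  have hder : ∀ t ∈ Ioo 0 b, Real.exp (-(1 / 4)) * Real.exp (-t) * f t ≤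
      Real.exp (-t - 1 / (4 * (1 + t))) * ((-1 + 1 / (4 * (1 + t) ^ 2)) * (w t + w' t) +
        (w' t + ((1 + κ / (1 + t) ^ 2) * w t + f t))) := by
    intro t ht
    have ht0 := ht.1
    obtain ⟨h1, h2⟩ := hnn t ⟨ht.1.le, ht.2.le⟩
    have h3 : Real.exp (-(1 / 4)) * Real.exp (-t) ≤ Real.exp (-t - 1 / (4 * (1 + t))) := by
      rw [← Real.exp_add]
      apply Real.exp_le_exp.2
      have : 1 / (4 * (1 + t)) ≤ 1 / 4 := by
        apply one_div_le_one_div_of_le <;> linarith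
      linarith
    refine mul_le_mul h3 ?_ (hf t ht) (Real.exp_pos _).le
    have h4 : (1 : ℝ) / (4 * (1 + t) ^ 2) = 1 / 4 * (1 / (1 + t) ^ 2) := by field_simp
    have h5 : (0 : ℝ) ≤ 1 / (1 + t) ^ 2 := by positivity
    rw [h4]
    nlinarith [hκt t ht, mul_nonneg h5 h2, mul_le_mul_of_nonneg_right (hκt t ht) h1]
  refine ⟨⟨_, fun t ht => ⟨hasDerivAt_growth ht.1 (hd t ht) (hd' t ht), hder t ht⟩⟩, ?_⟩
  intro t ht ht1
  have hb : (0 : ℝ) ∈ Icc 0 b := ⟨le_rfl, ht.1.trans ht.2⟩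
  have hGmono := monotoneOn_Icc_of_hasDerivAt_nonneg (continuousOn_growth hw hw')
    (fun t ht => hasDerivAt_growth ht.1 (hd t ht) (hd' t ht)) fun t ht => le_trans
      (mul_nonneg (by positivity) (hf t ht)) (hder t ht)
  -- The derivative is e^t (w'/4 + (1/4 + κ/(1+t)²) w + f), which is nonnegative since κ/(1+t)² ≥
  -- -1/4. This controls w' from below in terms of w, up to the initial error (3/4) w(0).
  have hmono := monotoneOn_Icc_of_hasDerivAt_nonneg (a := 0) (b := b)
    (f := fun t => Real.exp t * (w' t - 3 / 4 * w t))
    (f' := fun t => Real.exp t * (w' t - 3 / 4 * w t) + Real.exp t *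
      ((1 + κ / (1 + t) ^ 2) * w t + f t - 3 / 4 * w' t))
    (Real.continuous_exp.continuousOn.mul (hw'.sub (continuousOn_const.mul hw)))
    (fun t ht => (Real.hasDerivAt_exp t).mul ((hd' t ht).sub ((hd t ht).const_mul _))) (by
      intro t ht
      obtain ⟨h1, h2⟩ := hnn t ⟨ht.1.le, ht.2.le⟩
      rw [← mul_add]
      apply mul_nonneg (Real.exp_pos _).le
      nlinarith [mul_le_mul_of_nonneg_right (hκt t ht) h1, hf t ht,
        mul_le_mul_of_nonneg_right (hinv t ht) h1])
  have hw1 := hmono hb ht ht.1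
  have hG1 := hGmono hb ht ht.1
  simp only [Real.exp_zero, one_mul, growth] at hw1 hG1
  obtain ⟨h1, h2⟩ := hnn t ht
  have e1 : Real.exp t * growth w w' t ≤ w t + w' t := by
    unfold growth
    rw [← mul_assoc, ← Real.exp_add]
    refine mul_le_of_le_one_left (by positivity) ?_
    rw [Real.exp_le_one_iff]
    have : 0 ≤ 1 / (4 * (1 + t)) := by have := ht.1; positivity
    linarith
  have e2 : Real.exp (-(1 / 4)) * w 0 ≤ Real.exp (-t) * (w t + w' t) := by
    have a1 : Real.exp (-(1 / 4)) * w 0 ≤ Real.exp (-0 - 1 / (4 * (1 + 0))) * (w 0 + w' 0) := by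
      norm_num
      exact mul_le_mul_of_nonneg_left (by linarith) (Real.exp_pos _).le
    refine a1.trans (hG1.trans (mul_le_mul_of_nonneg_right ?_ (by positivity)))
    rw [Real.exp_le_exp]
    have : 0 ≤ 1 / (4 * (1 + t)) := by have := ht.1; positivity
    linarith
  -- `w 0` is at most a fifth of `e^t (w + w')`
  have e3 : 5 * w 0 ≤ Real.exp t * (w t + w' t) := by
    have a1 : w 0 ≤ Real.exp (1 / 4 - t) * (w t + w' t) := by
      have := mul_le_mul_of_nonneg_left e2 (Real.exp_pos (1 / 4)).le
      rw [← mul_assoc, ← mul_assoc, ← Real.exp_add, ← Real.exp_add] at this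
      simpa [sub_eq_add_neg] using this
    have a2 : 5 * Real.exp (1 / 4 - t) ≤ Real.exp t := by
      have : Real.exp t = Real.exp (2 * t - 1 / 4) * Real.exp (1 / 4 - t) := by
        rw [← Real.exp_add]; ring_nf
      rw [this]
      refine mul_le_mul_of_nonneg_right ?_ (Real.exp_pos _).le
      -- Here t ≥ 1 enters: 2t - 1/4 ≥ 7/4 and e^{7/4} > 5.
      have : Real.exp (7 / 4) ≤ Real.exp (2 * t - 1 / 4) := Real.exp_le_exp.2 (by linarith)
      have h3 : (5 : ℝ) ≤ Real.exp (7 / 4) := by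
        have := Real.exp_one_gt_d9
        have h4 : Real.exp (7 / 4) = Real.exp 1 * Real.exp (3 / 4) := by
          rw [← Real.exp_add]; norm_num
        have h5 := Real.quadratic_le_exp_of_nonneg (x := 3 / 4) (by norm_num)
        rw [h4]; nlinarith
      linarith
    nlinarith
  have e4 : -(3 / 4 * w 0) ≤ Real.exp t * (w' t - 3 / 4 * w t) := by linarith
  refine e1.trans ?_
  -- Combine `e4` with `e3` and divide by e^t. The result gives (23/4) w' ≥ 3 w, more than the 7 w'
  -- ≥ 2 w that is equivalent to w + w' ≤ 8 (w' - w/8).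
  have e5 : -(3 / 4 * (w t + w' t)) ≤ 5 * (w' t - 3 / 4 * w t) := by
    have := Real.exp_pos t
    by_contra! hcon
    have := mul_lt_mul_of_pos_left hcon this
    nlinarith
  linarith

end

/-- An integrated form of the differential inequality `G' ≥ k G^p φ`. -/
lemma integrated_superlinear_inequality {a b k p g₀ : ℝ} {G G' Φ φ : ℝ → ℝ} (hab : a ≤ b)
    (hp : 1 < p)
    (hG : ContinuousOn G (Icc a b)) (hd : ∀ t ∈ Ioo a b, HasDerivAt G (G' t) t)
    (hΦ : ContinuousOn Φ (Icc a b)) (hΦd : ∀ t ∈ Ioo a b, HasDerivAt Φ (φ t) t)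
    (hg₀ : 0 < g₀) (hG₀ : ∀ t ∈ Icc a b, g₀ ≤ G t)
    (hge : ∀ t ∈ Ioo a b, k * G t ^ p * φ t ≤ G' t) :
    (p - 1) * k * (Φ b - Φ a) ≤ g₀ ^ (1 - p) := by
  have hpos : ∀ t ∈ Icc a b, 0 < G t := fun t ht => hg₀.trans_le (hG₀ t ht)
  -- Separation of variables: -G^{1-p} grows at least as fast as (p-1) k Φ. At the end the term
  -- G(b)^{1-p} ≥ 0 is dropped.
  have hmono := monotoneOn_Icc_of_hasDerivAt_nonneg (a := a) (b := b)
    (f := fun t => -(G t ^ (1 - p)) - (p - 1) * k * Φ t)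
    (f' := fun t => -(G' t * (1 - p) * G t ^ (1 - p - 1)) - (p - 1) * k * φ t)
    ((hG.rpow_const fun t ht => Or.inl (hpos t ht).ne').neg.sub (continuousOn_const.mul hΦ))
    (fun t ht => ((hd t ht).rpow_const (Or.inl (hpos t ⟨ht.1.le, ht.2.le⟩).ne')).neg.sub
      ((hΦd t ht).const_mul _)) (by
      intro t ht
      have hGt := hpos t ⟨ht.1.le, ht.2.le⟩
      have h1 : G t ^ p * G t ^ (1 - p - 1) = 1 := by
        rw [← Real.rpow_add hGt]; simp
      have h2 : k * φ t ≤ G' t * G t ^ (1 - p - 1) := by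
        calc k * φ t = k * φ t * (G t ^ p * G t ^ (1 - p - 1)) := by rw [h1, mul_one]
          _ = k * G t ^ p * φ t * G t ^ (1 - p - 1) := by ring
          _ ≤ _ := mul_le_mul_of_nonneg_right (hge t ht) (by positivity)
      nlinarith)
  have h1 := hmono ⟨le_rfl, hab⟩ ⟨hab, le_rfl⟩ hab
  have h2 : G a ^ (1 - p) ≤ g₀ ^ (1 - p) :=
    Real.rpow_le_rpow_of_nonpos hg₀ (hG₀ a ⟨le_rfl, hab⟩) (by linarith)
  have h3 : 0 ≤ G b ^ (1 - p) := Real.rpow_nonneg (hpos b ⟨hab, le_rfl⟩).le _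
  dsimp only at h1
  linarith

/-! ### The exponential weight -/

/-- The weight `x ↦ e^{x_i}`, which satisfies `Δ ω = ω`. -/
def expWeight {n : ℕ} (i : Fin n) (x : EuclideanSpace ℝ (Fin n)) : ℝ := Real.exp (x i)

lemma expWeight_pos {n : ℕ} (i : Fin n) (x : EuclideanSpace ℝ (Fin n)) : 0 < expWeight i x :=
  Real.exp_pos _

lemma continuous_expWeight {n : ℕ} (i : Fin n) : Continuous (expWeight i) := by
  unfold expWeight
  fun_prop

/-- One-dimensional factors of a function dominating the exponential weight on a ball. -/
def weightFactor {n : ℕ} (i : Fin n) (r : ℝ) (j : Fin n) (s : ℝ) : ℝ :=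
  if j = i then (Iic r).indicator (fun s => Real.exp (2⁻¹ * s)) s
  else Real.exp (-(1 / (4 * r)) * s ^ 2)

lemma weightFactor_nonneg {n : ℕ} (i : Fin n) (r : ℝ) (j : Fin n) (s : ℝ) :
    0 ≤ weightFactor i r j s := by
  unfold weightFactor
  split_ifs
  · exact indicator_nonneg (fun _ _ => (Real.exp_pos _).le) _
  · positivity

lemma integrable_weightFactor {n : ℕ} (i : Fin n) {r : ℝ} (hr : 0 < r) (j : Fin n) :
    Integrable (weightFactor i r j) := by
  unfold weightFactor
  split_ifs
  · rw [integrable_indicator_iff measurableSet_Iic]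
    exact integrableOn_exp_mul_Iic (by norm_num) r
  · exact integrable_exp_neg_mul_sq (by positivity)

lemma integral_weightFactor {n : ℕ} (i : Fin n) (r : ℝ) (j : Fin n) :
    ∫ s, weightFactor i r j s =
      if j = i then 2 * Real.exp (2⁻¹ * r) else √(4 * Real.pi * r) := by
  unfold weightFactor
  split_ifs
  · rw [integral_indicator measurableSet_Iic, integral_exp_mul_Iic (by norm_num)]
    ring
  · rw [integral_gaussian]
    congr 1
    -- For r = 0 both sides are 0, since division by zero gives zero.
    by_cases hr : r = 0
    · simp [hr]
    · field_simp

/-- On the ball the coordinates other than x_i satisfy |x'|² ≤ (r - x_i)(r + x_i) ≤ 2r (r - x_i), so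
|x'|²/(4r) ≤ (r - x_i)/2. Near the pole where x_i = r the ball thus looks like a Gaussian of width
√r in the n - 1 transverse directions. -/
lemma expWeight_le_prod_weightFactor {n : ℕ} (i : Fin n) {r : ℝ} (hr : 0 < r)
    {x : EuclideanSpace ℝ (Fin n)} (hx : ‖x‖ ≤ r) :
    expWeight i x ≤ Real.exp (2⁻¹ * r) * ∏ j, weightFactor i r j (x j) := by
  have hsq : ∑ j, x j ^ 2 ≤ r ^ 2 := by
    have := EuclideanSpace.real_norm_sq_eq x
    rw [← this]
    exact pow_le_pow_left₀ (norm_nonneg _) hx 2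
  rw [← Finset.mul_prod_erase _ _ (Finset.mem_univ i)]
  rw [← Finset.add_sum_erase _ _ (Finset.mem_univ i)] at hsq
  have hxi : x i ≤ r := by
    have : 0 ≤ ∑ j ∈ Finset.univ.erase i, x j ^ 2 := Finset.sum_nonneg fun _ _ => sq_nonneg _
    exact le_of_sq_le_sq (by linarith) hr.le
  have h1 : weightFactor i r i (x i) = Real.exp (2⁻¹ * x i) := by
    simp [weightFactor, hxi]
  have h2 : ∏ j ∈ Finset.univ.erase i, weightFactor i r j (x j) =
      Real.exp (-(1 / (4 * r)) * ∑ j ∈ Finset.univ.erase i, x j ^ 2) := by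
    rw [Finset.mul_sum, Real.exp_sum]
    refine Finset.prod_congr rfl fun j hj => ?_
    simp [weightFactor, Finset.ne_of_mem_erase hj]
  rw [h1, h2, ← Real.exp_add, ← Real.exp_add, expWeight, Real.exp_le_exp]
  set S := ∑ j ∈ Finset.univ.erase i, x j ^ 2
  have h3 : 1 / (4 * r) * S ≤ 2⁻¹ * (r - x i) := by
    rw [div_mul_eq_mul_div, div_le_iff₀ (by positivity)]
    nlinarith [sq_nonneg (r - x i)]
  linarith

/-- The dominating product integrates factor by factor. The Gaussians give the power r^{(n-1)/2};
the trivial volume bound would give r^n and miss the critical exponent. -/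
lemma setIntegral_expWeight_le {n : ℕ} (i : Fin n) {r : ℝ} (hr : 0 < r) :
    ∫ x in Metric.closedBall (0 : EuclideanSpace ℝ (Fin n)) r, expWeight i x ≤
      2 * Real.exp r * √(4 * Real.pi * r) ^ (n - 1) := by
  have hmp := EuclideanSpace.volume_preserving_symm_measurableEquiv_toLp (Fin n)
  set P : EuclideanSpace ℝ (Fin n) → ℝ := fun x => ∏ j, weightFactor i r j (x j) with hP
  have hint : Integrable P := by
    have h1 : Integrable (fun y : Fin n → ℝ => ∏ j, weightFactor i r j (y j)) :=
      Integrable.fintype_prod fun j => integrable_weightFactor i hr j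
    exact hmp.integrable_comp_of_integrable h1
  have hval : ∫ x, P x = 2 * Real.exp (2⁻¹ * r) * √(4 * Real.pi * r) ^ (n - 1) := by
    have h1 := hmp.integral_comp'
      (fun y : Fin n → ℝ => ∏ j, weightFactor i r j (y j))
    rw [integral_fintype_prod_volume_eq_prod (f := weightFactor i r)] at h1
    have h2 : ∏ j, ∫ s, weightFactor i r j s =
        2 * Real.exp (2⁻¹ * r) * √(4 * Real.pi * r) ^ (n - 1) := by
      simp_rw [integral_weightFactor]
      rw [← Finset.mul_prod_erase _ _ (Finset.mem_univ i)]
      rw [Finset.prod_congr rfl (g := fun _ => √(4 * Real.pi * r))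
        (fun j hj => by simp [Finset.ne_of_mem_erase hj])]
      simp
    rw [h2] at h1
    exact h1
  calc ∫ x in Metric.closedBall (0 : EuclideanSpace ℝ (Fin n)) r, expWeight i x
      ≤ ∫ x in Metric.closedBall (0 : EuclideanSpace ℝ (Fin n)) r, Real.exp (2⁻¹ * r) * P x := by
        refine setIntegral_mono_on ?_ (hint.const_mul _).integrableOn
          Metric.isClosed_closedBall.measurableSet ?_
        · exact (continuous_expWeight i).continuousOn.integrableOn_compact
            (isCompact_closedBall _ _)
        · intro x hx
          exact expWeight_le_prod_weightFactor i hr (by simpa using hx)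
    _ ≤ ∫ x, Real.exp (2⁻¹ * r) * P x := by
        refine setIntegral_le_integral (hint.const_mul _) (Filter.Eventually.of_forall fun x => ?_)
        exact mul_nonneg (Real.exp_pos _).le (Finset.prod_nonneg fun j _ => weightFactor_nonneg ..)
    _ = _ := by
        rw [integral_const_mul, hval]
        have : Real.exp r = Real.exp (2⁻¹ * r) * Real.exp (2⁻¹ * r) := by
          rw [← Real.exp_add]; ring_nf
        rw [this]; ring

/-- The mass of the weight in the forward light cone over `B_R`. -/
lemma exists_setIntegral_expWeight_le {n : ℕ} (i : Fin n) {R : ℝ} (hR : 0 < R) :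
    ∃ K > 0, ∀ t, 0 ≤ t →
      ∫ x in Metric.closedBall (0 : EuclideanSpace ℝ (Fin n)) (R + t), expWeight i x ≤
        K * (Real.exp t * (1 + t) ^ (((n : ℝ) - 1) / 2)) := by
  have hn : 1 ≤ n := Nat.one_le_of_lt i.2
  refine ⟨2 * Real.exp R * √(4 * Real.pi * (1 + R)) ^ (n - 1), by positivity, fun t ht => ?_⟩
  refine (setIntegral_expWeight_le i (by linarith)).trans ?_
  -- Uses R + t ≤ (1 + R)(1 + t).
  have h1 : √(4 * Real.pi * (R + t)) ≤ √(4 * Real.pi * (1 + R)) * √(1 + t) := by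
    rw [← Real.sqrt_mul (by positivity)]
    apply Real.sqrt_le_sqrt
    rw [mul_assoc (4 * Real.pi)]
    exact mul_le_mul_of_nonneg_left (by nlinarith) (by positivity)
  have h2 : √(1 + t) ^ (n - 1) = (1 + t) ^ (((n : ℝ) - 1) / 2) := by
    rw [Real.sqrt_eq_rpow, ← Real.rpow_natCast, ← Real.rpow_mul (by linarith),
      Nat.cast_sub hn]
    congr 1
    push_cast
    ring
  calc 2 * Real.exp (R + t) * √(4 * Real.pi * (R + t)) ^ (n - 1)
      ≤ 2 * Real.exp (R + t) * (√(4 * Real.pi * (1 + R)) * √(1 + t)) ^ (n - 1) := by gcongr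
    _ = _ := by
      rw [mul_pow, h2, Real.exp_add]; ring

/-! ### Integrals depending on a parameter -/

section ParametricIntegral

variable {X : Type*} [NormedAddCommGroup X] [InnerProductSpace ℝ X] [FiniteDimensional ℝ X]
  [MeasurableSpace X] [BorelSpace X]

lemma integrable_of_continuous_of_eq_zero {f : X → ℝ} {K : Set X} (hK : IsCompact K)
    (hf : Continuous f) (h0 : ∀ x ∉ K, f x = 0) : Integrable f :=
  hf.integrable_of_hasCompactSupport (HasCompactSupport.intro hK h0)

/-- Integration by parts against the constant function 1. It disposes of every divergence term
below. -/
lemma integral_fderiv_apply_eq_zero {f : X → ℝ} {K : Set X} (hK : IsCompact K)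
    (hf : ContDiff ℝ 1 f) (h0 : ∀ x ∉ K, f x = 0) (v : X) :
    Integrable (fun x => fderiv ℝ f x v) ∧ ∫ x, fderiv ℝ f x v = 0 := by
  have hcs : HasCompactSupport f := HasCompactSupport.intro hK h0
  have hc : Continuous fun x => fderiv ℝ f x v :=
    (hf.continuous_fderiv one_ne_zero).clm_apply continuous_const
  have hi : Integrable fun x => fderiv ℝ f x v :=
    hc.integrable_of_hasCompactSupport (hcs.fderiv_apply ℝ v)
  refine ⟨hi, ?_⟩
  have h := integral_mul_fderiv_eq_neg_fderiv_mul_of_integrable (μ := volume)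
    (f := fun _ : X => (1 : ℝ)) (g := f) (v := v) (by simp) (by simpa using hi)
    (by simpa using hf.continuous.integrable_of_hasCompactSupport hcs) (by simp)
    (fun x _ => hf.differentiable one_ne_zero x)
  simpa using h

/-- F' vanishes off K because F does for all nearby times, so near t it is dominated by a constant
multiple of the indicator of K. -/
lemma hasDerivAt_integral_of_compact_support {s : Set ℝ} (hs : IsOpen s) {K : Set X}
    (hK : IsCompact K) {F F' : ℝ → X → ℝ}
    (hF : ContinuousOn (fun q : ℝ × X => F q.1 q.2) (s ×ˢ univ))
    (hF' : ContinuousOn (fun q : ℝ × X => F' q.1 q.2) (s ×ˢ univ))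
    (hd : ∀ t ∈ s, ∀ x, HasDerivAt (fun r => F r x) (F' t x) t)
    (h0 : ∀ t ∈ s, ∀ x ∉ K, F t x = 0) {t : ℝ} (ht : t ∈ s) :
    Integrable (F' t) ∧ HasDerivAt (fun r => ∫ x, F r x) (∫ x, F' t x) t := by
  have hcont : ∀ r ∈ s, Continuous (F r) := fun r hr =>
    continuousOn_univ.1 (hF.comp (f := fun x : X => (r, x)) (by fun_prop)
      fun x _ => ⟨hr, mem_univ _⟩)
  have hcont' : ∀ r ∈ s, Continuous (F' r) := fun r hr =>
    continuousOn_univ.1 (hF'.comp (f := fun x : X => (r, x)) (by fun_prop)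
      fun x _ => ⟨hr, mem_univ _⟩)
  have h0' : ∀ r ∈ s, ∀ x ∉ K, F' r x = 0 := by
    intro r hr x hx
    have h1 : (fun r => F r x) =ᶠ[𝓝 r] fun _ => 0 := by
      filter_upwards [hs.mem_nhds hr] with r' hr'
      exact h0 r' hr' x hx
    exact (hd r hr x).unique (h1.hasDerivAt_iff.2 (hasDerivAt_const r 0))
  obtain ⟨ρ, hρ, hball⟩ := Metric.nhds_basis_closedBall.mem_iff.1 (hs.mem_nhds ht)
  have hcomp : IsCompact (Metric.closedBall t ρ ×ˢ K) := (isCompact_closedBall t ρ).prod hK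
  obtain ⟨M, hM⟩ := hcomp.exists_bound_of_continuousOn
    (hF'.mono (prod_mono hball (subset_univ K)))
  refine hasDerivAt_integral_of_dominated_loc_of_deriv_le (bound := K.indicator fun _ => M)
    (Metric.closedBall_mem_nhds t hρ) ?_
    (integrable_of_continuous_of_eq_zero hK (hcont t ht) (h0 t ht))
    (hcont' t ht).aestronglyMeasurable ?_ ?_ ?_
  · filter_upwards [hs.mem_nhds ht] with r hr
    exact (hcont r hr).aestronglyMeasurable
  · refine Filter.Eventually.of_forall fun x r hr => ?_
    by_cases hx : x ∈ K
    · simpa [hx] using hM (r, x) ⟨hr, hx⟩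
    · simp [hx, h0' r (hball hr) x hx]
  · rw [integrable_indicator_iff hK.measurableSet]
    exact integrableOn_const hK.measure_ne_top
  · exact Filter.Eventually.of_forall fun x r hr => hd r (hball hr) x

end ParametricIntegral

/-! ### Regularity of solutions -/

lemma isOpen_coe_lt (T : EReal) : IsOpen {t : ℝ | (t : EReal) < T} :=
  isOpen_Iio.preimage continuous_coe_real_ereal

lemma isOpen_timeIoo (T : EReal) : IsOpen (timeIoo T) := isOpen_Ioi.inter (isOpen_coe_lt T)

lemma timeIoo_subset_timeIco (T : EReal) : timeIoo T ⊆ timeIco T := fun _ ht => ⟨ht.1.le, ht.2⟩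

lemma uniqueDiffOn_timeIco (T : EReal) : UniqueDiffOn ℝ (timeIco T) :=
  (uniqueDiffOn_Ici 0).inter (isOpen_coe_lt T)

/-- The time derivative, one-sided at the initial time. -/
def velocity {X : Type*} (u : ℝ → X → ℝ) (t : ℝ) (x : X) : ℝ :=
  derivWithin (fun s => u s x) (Ici 0) t

/-- The `i`-th spatial partial derivative. -/
def partialDeriv {n : ℕ} (f : EuclideanSpace ℝ (Fin n) → ℝ) (i : Fin n)
    (x : EuclideanSpace ℝ (Fin n)) : ℝ :=
  fderiv ℝ f x (EuclideanSpace.single i 1)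

lemma laplacian_eq_sum_partialDeriv {n : ℕ} {f : EuclideanSpace ℝ (Fin n) → ℝ}
    (hf : ContDiff ℝ 2 f) (x : EuclideanSpace ℝ (Fin n)) :
    Δ f x = ∑ i, partialDeriv (partialDeriv f i) i x := by
  rw [InnerProductSpace.laplacian_eq_iteratedFDeriv_orthonormalBasis f
    (EuclideanSpace.basisFun (Fin n) ℝ)]
  refine Finset.sum_congr rfl fun i _ => ?_
  have hd : DifferentiableAt ℝ (fderiv ℝ f) x :=
    (hf.fderiv_right (m := 1) (by norm_num)).differentiable one_ne_zero x
  have h1 : HasFDerivAt (partialDeriv f i)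
      ((fderiv ℝ (fderiv ℝ f) x).flip (EuclideanSpace.single i 1)) x := by
    refine (hd.hasFDerivAt.clm_apply
      (hasFDerivAt_const (EuclideanSpace.single i (1 : ℝ)) x)).congr_fderiv ?_
    simp
  rw [iteratedFDeriv_two_apply, partialDeriv, h1.fderiv]
  simp

namespace IsSolution

variable {n : ℕ} {μ ν p ε : ℝ} {u₀ u₁ : EuclideanSpace ℝ (Fin n) → ℝ} {T : EReal}
  {u : ℝ → EuclideanSpace ℝ (Fin n) → ℝ}

lemma continuousOn (h : IsSolution μ ν p ε u₀ u₁ T u) :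
    ContinuousOn (fun q : ℝ × EuclideanSpace ℝ (Fin n) => u q.1 q.2) (timeIco T ×ˢ univ) :=
  h.contDiffOn_one.continuousOn

lemma hasFDerivWithinAt (h : IsSolution μ ν p ε u₀ u₁ T u) {t : ℝ} (ht : t ∈ timeIco T)
    (x : EuclideanSpace ℝ (Fin n)) :
    HasFDerivWithinAt (fun q : ℝ × EuclideanSpace ℝ (Fin n) => u q.1 q.2)
      (fderivWithin ℝ (fun q : ℝ × EuclideanSpace ℝ (Fin n) => u q.1 q.2)
        (timeIco T ×ˢ univ) (t, x)) (timeIco T ×ˢ univ) (t, x) :=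
  (h.contDiffOn_one.differentiableOn one_ne_zero (t, x) ⟨ht, mem_univ _⟩).hasFDerivWithinAt

lemma velocity_eq (h : IsSolution μ ν p ε u₀ u₁ T u) {t : ℝ} (ht : t ∈ timeIco T)
    (x : EuclideanSpace ℝ (Fin n)) :
    velocity u t x = fderivWithin ℝ (fun q : ℝ × EuclideanSpace ℝ (Fin n) => u q.1 q.2)
        (timeIco T ×ˢ univ) (t, x) (1, 0) := by
  have h1 : HasDerivWithinAt (fun s : ℝ => (s, x)) (1, 0) (timeIco T) t :=
    ((hasDerivAt_id t).prodMk (hasDerivAt_const t x)).hasDerivWithinAt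
  have hmaps : MapsTo (fun s : ℝ => (s, x)) (timeIco T) (timeIco T ×ˢ univ) :=
    fun s hs => ⟨hs, mem_univ _⟩
  have h2 := (h.hasFDerivWithinAt ht x).comp_hasDerivWithinAt t h1 hmaps
  -- Near t the intervals [0, T) and [0, ∞) coincide, so the two within-derivatives agree.
  have h3 : timeIco T ∈ 𝓝[Ici 0] t :=
    inter_mem_nhdsWithin _ ((isOpen_coe_lt T).mem_nhds ht.2)
  exact (h2.mono_of_mem_nhdsWithin h3).derivWithin (uniqueDiffOn_Ici 0 t ht.1)

lemma partialDeriv_eq (h : IsSolution μ ν p ε u₀ u₁ T u) {t : ℝ} (ht : t ∈ timeIco T)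
    (i : Fin n) (x : EuclideanSpace ℝ (Fin n)) :
    partialDeriv (u t) i x = fderivWithin ℝ (fun q : ℝ × EuclideanSpace ℝ (Fin n) => u q.1 q.2)
        (timeIco T ×ˢ univ) (t, x) (0, EuclideanSpace.single i 1) := by
  have h1 : HasFDerivWithinAt (fun y : EuclideanSpace ℝ (Fin n) => (t, y))
      (ContinuousLinearMap.inr ℝ ℝ _) univ x := (hasFDerivAt_prodMk_right t x).hasFDerivWithinAt
  have h2 := (h.hasFDerivWithinAt ht x).comp x h1 fun s hs => ⟨ht, mem_univ _⟩
  have h3 := (hasFDerivWithinAt_univ.1 h2).fderiv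
  unfold partialDeriv
  have h4 : fderiv ℝ (u t) x = _ := h3
  rw [h4]
  simp

lemma continuousOn_fderivWithin_apply (h : IsSolution μ ν p ε u₀ u₁ T u)
    (v : ℝ × EuclideanSpace ℝ (Fin n)) :
    ContinuousOn (fun q => fderivWithin ℝ (fun q : ℝ × EuclideanSpace ℝ (Fin n) => u q.1 q.2)
        (timeIco T ×ˢ univ) q v) (timeIco T ×ˢ univ) :=
  (h.contDiffOn_one.continuousOn_fderivWithin
    ((uniqueDiffOn_timeIco T).prod uniqueDiffOn_univ) le_rfl).clm_apply continuousOn_const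

lemma continuousOn_velocity (h : IsSolution μ ν p ε u₀ u₁ T u) :
    ContinuousOn (fun q : ℝ × EuclideanSpace ℝ (Fin n) => velocity u q.1 q.2)
      (timeIco T ×ˢ univ) :=
  (h.continuousOn_fderivWithin_apply (1, 0)).congr fun q hq => h.velocity_eq hq.1 q.2

lemma continuousOn_partialDeriv (h : IsSolution μ ν p ε u₀ u₁ T u) (i : Fin n) :
    ContinuousOn (fun q : ℝ × EuclideanSpace ℝ (Fin n) => partialDeriv (u q.1) i q.2)
      (timeIco T ×ˢ univ) :=
  (h.continuousOn_fderivWithin_apply (0, EuclideanSpace.single i 1)).congr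
    fun q hq => h.partialDeriv_eq hq.1 i q.2

lemma fderivWithin_eq_fderiv {t : ℝ} (ht : t ∈ timeIoo T)
    (x : EuclideanSpace ℝ (Fin n)) :
    fderivWithin ℝ (fun q : ℝ × EuclideanSpace ℝ (Fin n) => u q.1 q.2) (timeIco T ×ˢ univ) (t, x) =
      fderiv ℝ (fun q : ℝ × EuclideanSpace ℝ (Fin n) => u q.1 q.2) (t, x) :=
  fderivWithin_of_mem_nhds (Filter.mem_of_superset
    (((isOpen_timeIoo T).prod isOpen_univ).mem_nhds ⟨ht, mem_univ _⟩)
    (prod_mono (timeIoo_subset_timeIco T) le_rfl))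

lemma velocity_eq_deriv {t : ℝ} (ht : 0 < t) (x : EuclideanSpace ℝ (Fin n)) :
    velocity u t x = deriv (fun s => u s x) t :=
  derivWithin_of_mem_nhds (Ici_mem_nhds ht)

lemma contDiffOn_fderiv (h : IsSolution μ ν p ε u₀ u₁ T u) :
    ContDiffOn ℝ 1 (fderiv ℝ (fun q : ℝ × EuclideanSpace ℝ (Fin n) => u q.1 q.2))
      (timeIoo T ×ˢ univ) :=
  h.contDiffOn_two.fderiv_of_isOpen ((isOpen_timeIoo T).prod isOpen_univ) (by norm_num)

lemma contDiffOn_fderiv_apply (h : IsSolution μ ν p ε u₀ u₁ T u)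
    (v : ℝ × EuclideanSpace ℝ (Fin n)) :
    ContDiffOn ℝ 1 (fun q => fderiv ℝ (fun q : ℝ × EuclideanSpace ℝ (Fin n) => u q.1 q.2) q v)
      (timeIoo T ×ˢ univ) :=
  h.contDiffOn_fderiv.clm_apply contDiffOn_const

lemma contDiffOn_velocity (h : IsSolution μ ν p ε u₀ u₁ T u) :
    ContDiffOn ℝ 1 (fun q : ℝ × EuclideanSpace ℝ (Fin n) => velocity u q.1 q.2)
      (timeIoo T ×ˢ univ) :=
  (h.contDiffOn_fderiv_apply (1, 0)).congr fun q hq => by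
    rw [h.velocity_eq (timeIoo_subset_timeIco T hq.1) q.2, fderivWithin_eq_fderiv hq.1]

lemma contDiffOn_partialDeriv (h : IsSolution μ ν p ε u₀ u₁ T u) (i : Fin n) :
    ContDiffOn ℝ 1 (fun q : ℝ × EuclideanSpace ℝ (Fin n) => partialDeriv (u q.1) i q.2)
      (timeIoo T ×ˢ univ) :=
  (h.contDiffOn_fderiv_apply (0, EuclideanSpace.single i 1)).congr fun q hq => by
    rw [h.partialDeriv_eq (timeIoo_subset_timeIco T hq.1) i q.2, fderivWithin_eq_fderiv hq.1]

end IsSolution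

lemma continuous_slice {X : Type*} [TopologicalSpace X] {s : Set ℝ} {F : ℝ → X → ℝ}
    (hF : ContinuousOn (fun q : ℝ × X => F q.1 q.2) (s ×ˢ univ))
    {t : ℝ} (ht : t ∈ s) : Continuous (F t) :=
  continuousOn_univ.1 (hF.comp (f := fun x : X => (t, x)) (by fun_prop) fun x _ => ⟨ht, mem_univ _⟩)

/-! ### Time and space derivatives of a function on a space-time strip -/

section Slices

variable {X : Type*} [NormedAddCommGroup X] [NormedSpace ℝ X] {s : Set ℝ} {F : ℝ → X → ℝ}

lemma contDiff_slice {m : ℕ} (hF : ContDiffOn ℝ m (fun q : ℝ × X => F q.1 q.2) (s ×ˢ univ))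
    {t : ℝ} (ht : t ∈ s) : ContDiff ℝ m (F t) :=
  contDiffOn_univ.1 (hF.comp (f := fun x : X => (t, x)) (by fun_prop) fun x _ => ⟨ht, mem_univ _⟩)

lemma hasDerivAt_slice (hs : IsOpen s)
    (hF : ContDiffOn ℝ 1 (fun q : ℝ × X => F q.1 q.2) (s ×ˢ univ)) {t : ℝ} (ht : t ∈ s) (x : X) :
    HasDerivAt (fun r => F r x) (fderiv ℝ (fun q : ℝ × X => F q.1 q.2) (t, x) (1, 0)) t := by
  have hd : DifferentiableAt ℝ (fun q : ℝ × X => F q.1 q.2) (t, x) :=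
    (hF.differentiableOn one_ne_zero).differentiableAt
      ((hs.prod isOpen_univ).mem_nhds ⟨ht, mem_univ _⟩)
  exact hd.hasFDerivAt.comp_hasDerivAt t ((hasDerivAt_id t).prodMk (hasDerivAt_const t x))

lemma fderiv_slice_apply (hs : IsOpen s)
    (hF : ContDiffOn ℝ 1 (fun q : ℝ × X => F q.1 q.2) (s ×ˢ univ)) {t : ℝ} (ht : t ∈ s) (x v : X) :
    fderiv ℝ (F t) x v = fderiv ℝ (fun q : ℝ × X => F q.1 q.2) (t, x) (0, v) := by
  have hd : DifferentiableAt ℝ (fun q : ℝ × X => F q.1 q.2) (t, x) :=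
    (hF.differentiableOn one_ne_zero).differentiableAt
      ((hs.prod isOpen_univ).mem_nhds ⟨ht, mem_univ _⟩)
  have h1 : HasFDerivAt (F t) _ x := hd.hasFDerivAt.comp x (hasFDerivAt_prodMk_right t x)
  rw [h1.fderiv]
  simp

lemma continuousOn_fderiv_slice (hs : IsOpen s)
    (hF : ContDiffOn ℝ 1 (fun q : ℝ × X => F q.1 q.2) (s ×ˢ univ)) (v : ℝ × X) :
    ContinuousOn (fun q => fderiv ℝ (fun q : ℝ × X => F q.1 q.2) q v) (s ×ˢ univ) :=
  (hF.continuousOn_fderiv_of_isOpen (hs.prod isOpen_univ) le_rfl).clm_apply continuousOn_const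

end Slices

namespace IsSolution

variable {n : ℕ} {μ ν p ε : ℝ} {u₀ u₁ : EuclideanSpace ℝ (Fin n) → ℝ} {T : EReal}
  {u : ℝ → EuclideanSpace ℝ (Fin n) → ℝ}

lemma hasDerivAt_velocity (h : IsSolution μ ν p ε u₀ u₁ T u) {t : ℝ} (ht : t ∈ timeIoo T)
    (x : EuclideanSpace ℝ (Fin n)) : HasDerivAt (fun s => u s x) (velocity u t x) t := by
  have h1 := hasDerivAt_slice (isOpen_timeIoo T) (h.contDiffOn_two.of_le (by norm_num)) ht x
  rw [h.velocity_eq (timeIoo_subset_timeIco T ht), fderivWithin_eq_fderiv ht]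
  exact h1

lemma hasDerivAt_deriv_velocity (h : IsSolution μ ν p ε u₀ u₁ T u) {t : ℝ} (ht : t ∈ timeIoo T)
    (x : EuclideanSpace ℝ (Fin n)) :
    HasDerivAt (fun s => velocity u s x) (deriv (fun s => velocity u s x) t) t :=
  (hasDerivAt_slice (isOpen_timeIoo T) h.contDiffOn_velocity ht x).differentiableAt.hasDerivAt

lemma continuousOn_deriv_velocity (h : IsSolution μ ν p ε u₀ u₁ T u) :
    ContinuousOn (fun q : ℝ × EuclideanSpace ℝ (Fin n) => deriv (fun s => velocity u s q.2) q.1)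
      (timeIoo T ×ˢ univ) :=
  (continuousOn_fderiv_slice (isOpen_timeIoo T) h.contDiffOn_velocity (1, 0)).congr fun q hq =>
    (hasDerivAt_slice (isOpen_timeIoo T) h.contDiffOn_velocity hq.1 q.2).deriv

lemma continuousOn_partialDeriv_velocity (h : IsSolution μ ν p ε u₀ u₁ T u) (i : Fin n) :
    ContinuousOn (fun q : ℝ × EuclideanSpace ℝ (Fin n) => partialDeriv (velocity u q.1) i q.2)
      (timeIoo T ×ˢ univ) :=
  (continuousOn_fderiv_slice (isOpen_timeIoo T) h.contDiffOn_velocity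
    (0, EuclideanSpace.single i 1)).congr fun q hq =>
    fderiv_slice_apply (isOpen_timeIoo T) h.contDiffOn_velocity hq.1 q.2 _

/-- Time and space derivatives commute. -/
lemma hasDerivAt_partialDeriv (h : IsSolution μ ν p ε u₀ u₁ T u) {t : ℝ} (ht : t ∈ timeIoo T)
    (i : Fin n) (x : EuclideanSpace ℝ (Fin n)) :
    HasDerivAt (fun s => partialDeriv (u s) i x) (partialDeriv (velocity u t) i x) t := by
  have hopen := isOpen_timeIoo T
  have hmem : timeIoo T ×ˢ univ ∈ 𝓝 (t, x) :=
    (hopen.prod isOpen_univ).mem_nhds ⟨ht, mem_univ _⟩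
  set U : ℝ × EuclideanSpace ℝ (Fin n) → ℝ := fun q => u q.1 q.2 with hU
  have hdiff : DifferentiableAt ℝ (fderiv ℝ U) (t, x) :=
    (h.contDiffOn_fderiv.differentiableOn one_ne_zero).differentiableAt hmem
  have happly : ∀ v w : ℝ × EuclideanSpace ℝ (Fin n),
      fderiv ℝ (fun q => fderiv ℝ U q v) (t, x) w = fderiv ℝ (fderiv ℝ U) (t, x) w v := by
    intro v w
    have h1 := hdiff.hasFDerivAt.clm_apply (hasFDerivAt_const v (t, x))
    rw [h1.fderiv]
    simp
  -- Both mixed derivatives are values of D²U at (t, x), which is symmetric because U is C² for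
  -- positive times.
  have hsymm : IsSymmSndFDerivAt ℝ U (t, x) :=
    (h.contDiffOn_two.contDiffAt hmem).isSymmSndFDerivAt (by simp)
  have h1 := hasDerivAt_slice (F := fun t => partialDeriv (u t) i) hopen
    (h.contDiffOn_partialDeriv i) ht x
  have h2 := fderiv_slice_apply hopen h.contDiffOn_velocity ht x (EuclideanSpace.single i 1)
  have e1 : (fun q : ℝ × EuclideanSpace ℝ (Fin n) => partialDeriv (u q.1) i q.2) =ᶠ[𝓝 (t, x)]
      fun q => fderiv ℝ U q (0, EuclideanSpace.single i 1) := by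
    filter_upwards [hmem] with q hq
    rw [h.partialDeriv_eq (timeIoo_subset_timeIco T hq.1) i q.2, fderivWithin_eq_fderiv hq.1]
  have e2 : (fun q : ℝ × EuclideanSpace ℝ (Fin n) => velocity u q.1 q.2) =ᶠ[𝓝 (t, x)]
      fun q => fderiv ℝ U q (1, 0) := by
    filter_upwards [hmem] with q hq
    rw [h.velocity_eq (timeIoo_subset_timeIco T hq.1) q.2, fderivWithin_eq_fderiv hq.1]
  rw [e1.fderiv_eq, happly, hsymm.eq] at h1
  rw [e2.fderiv_eq, happly] at h2
  rw [partialDeriv, h2]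
  exact h1

lemma contDiff_slice_two (h : IsSolution μ ν p ε u₀ u₁ T u) {t : ℝ} (ht : t ∈ timeIoo T) :
    ContDiff ℝ 2 (u t) := contDiff_slice (m := 2) h.contDiffOn_two ht

lemma contDiff_slice_velocity (h : IsSolution μ ν p ε u₀ u₁ T u) {t : ℝ} (ht : t ∈ timeIoo T) :
    ContDiff ℝ 1 (velocity u t) := contDiff_slice (m := 1) h.contDiffOn_velocity ht

lemma contDiff_slice_partialDeriv (h : IsSolution μ ν p ε u₀ u₁ T u) {t : ℝ} (ht : t ∈ timeIoo T)
    (i : Fin n) : ContDiff ℝ 1 (partialDeriv (u t) i) :=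
  contDiff_slice (F := fun t => partialDeriv (u t) i) (m := 1) (h.contDiffOn_partialDeriv i) ht

/-- The equation in terms of the first-order partial derivatives. -/
lemma deriv_velocity_eq (h : IsSolution μ ν p ε u₀ u₁ T u) {t : ℝ} (ht : t ∈ timeIoo T)
    (x : EuclideanSpace ℝ (Fin n)) :
    deriv (fun s => velocity u s x) t = ∑ i, partialDeriv (partialDeriv (u t) i) i x
      - μ / (1 + t) * velocity u t x - ν ^ 2 / (1 + t) ^ 2 * u t x + |velocity u t x| ^ p := by
  have h1 := h.equation t ht x
  have h2 : deriv (deriv fun s => u s x) t = deriv (fun s => velocity u s x) t := by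
    refine Filter.EventuallyEq.deriv_eq ?_
    filter_upwards [Ioi_mem_nhds ht.1] with s hs
    exact (velocity_eq_deriv hs x).symm
  rw [laplacian_eq_sum_partialDeriv (h.contDiff_slice_two ht), h2,
    ← velocity_eq_deriv (u := u) ht.1 x] at h1
  linarith

lemma zero_mem (h : IsSolution μ ν p ε u₀ u₁ T u) : (0 : ℝ) ∈ timeIco T :=
  ⟨le_rfl, by simpa using h.pos⟩

lemma velocity_zero (h : IsSolution μ ν p ε u₀ u₁ T u) (x : EuclideanSpace ℝ (Fin n)) :
    velocity u 0 x = ε * u₁ x :=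
  (h.initial_velocity x).derivWithin (uniqueDiffOn_Ici 0 0 self_mem_Ici)

end IsSolution

/-! ### Finite speed of propagation -/

/-- At 0 the function is O(s²). Squaring the positive part makes the cone cutoff C¹, as the
divergence theorem requires. -/
lemma hasDerivAt_max_zero_sq (s : ℝ) :
    HasDerivAt (fun s : ℝ => max s 0 ^ 2) (2 * max s 0) s := by
  rcases lt_trichotomy s 0 with hs | rfl | hs
  · rw [max_eq_right hs.le, mul_zero]
    refine (hasDerivAt_const s (0 : ℝ)).congr_of_eventuallyEq ?_
    filter_upwards [Iio_mem_nhds hs] with r hr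
    simp [max_eq_right (le_of_lt (mem_Iio.1 hr))]
  · have h1 : (fun s : ℝ => max s 0 ^ 2) =O[𝓝 0] fun s => ‖s - 0‖ ^ 2 := by
      refine Asymptotics.IsBigO.of_bound 1 (Filter.Eventually.of_forall fun s => ?_)
      rcases le_total s 0 with h | h
      · simp [max_eq_right h]
        positivity
      · simp [max_eq_left h]
    simpa using (h1.hasFDerivAt (by norm_num)).hasDerivAt
  · rw [max_eq_left hs.le]
    have h1 : HasDerivAt (fun s : ℝ => s ^ 2) (2 * s) s := by simpa using hasDerivAt_pow 2 s
    refine h1.congr_of_eventuallyEq ?_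
    filter_upwards [Ioi_mem_nhds hs] with r hr
    simp [max_eq_left (le_of_lt (mem_Ioi.1 hr))]

/-! ### The light-cone cutoff -/

section Cone

variable {n : ℕ}

/-- The positive part of `(t₀ - t)² - |x - x₀|²`, which is supported in a light cone. -/
def coneProfile (t₀ : ℝ) (x₀ : EuclideanSpace ℝ (Fin n)) (t : ℝ)
    (x : EuclideanSpace ℝ (Fin n)) : ℝ := max ((t₀ - t) ^ 2 - ∑ j, (x j - x₀ j) ^ 2) 0

variable {t₀ : ℝ} {x₀ : EuclideanSpace ℝ (Fin n)}

lemma coneProfile_nonneg (t : ℝ) (x : EuclideanSpace ℝ (Fin n)) : 0 ≤ coneProfile t₀ x₀ t x :=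
  le_max_right _ _

lemma continuous_coneProfile :
    Continuous fun q : ℝ × EuclideanSpace ℝ (Fin n) => coneProfile t₀ x₀ q.1 q.2 := by
  unfold coneProfile
  fun_prop

lemma sum_sq_sub_eq (x : EuclideanSpace ℝ (Fin n)) :
    ∑ j, (x j - x₀ j) ^ 2 = ‖x - x₀‖ ^ 2 := by
  simp [EuclideanSpace.real_norm_sq_eq]

lemma coneProfile_eq_zero {t : ℝ} (ht : 0 ≤ t) (ht₀ : t ≤ t₀) {x : EuclideanSpace ℝ (Fin n)}
    (hx : x ∉ Metric.closedBall x₀ t₀) : coneProfile t₀ x₀ t x = 0 := by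
  rw [coneProfile, sum_sq_sub_eq]
  refine max_eq_right ?_
  rw [Metric.mem_closedBall, not_le, dist_eq_norm] at hx
  nlinarith

lemma hasDerivAt_coneProfile_sq (t : ℝ) (x : EuclideanSpace ℝ (Fin n)) :
    HasDerivAt (fun s => coneProfile t₀ x₀ s x ^ 2)
      (-(4 * (t₀ - t)) * coneProfile t₀ x₀ t x) t := by
  have h1 : HasDerivAt (fun s => (t₀ - s) ^ 2 - ∑ j, (x j - x₀ j) ^ 2) (-(2 * (t₀ - t))) t := by
    have := (((hasDerivAt_id t).const_sub t₀).pow 2).sub_const (∑ j, (x j - x₀ j) ^ 2)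
    refine this.congr_deriv ?_
    simp
  refine ((hasDerivAt_max_zero_sq _).comp t h1).congr_deriv ?_
  unfold coneProfile
  ring

lemma hasFDerivAt_coneProfile_sq (t : ℝ) (x : EuclideanSpace ℝ (Fin n)) :
    ∃ L : EuclideanSpace ℝ (Fin n) →L[ℝ] ℝ, HasFDerivAt (fun y => coneProfile t₀ x₀ t y ^ 2)
      ((2 * coneProfile t₀ x₀ t x) • (-L)) x ∧
      ∀ i, L (EuclideanSpace.single i 1) = 2 * (x i - x₀ i) := by
  have hproj : ∀ j, HasFDerivAt (fun y : EuclideanSpace ℝ (Fin n) => (y j - x₀ j) ^ 2)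
      ((2 * (x j - x₀ j)) • (EuclideanSpace.proj j : EuclideanSpace ℝ (Fin n) →L[ℝ] ℝ)) x := by
    intro j
    have h1 : HasFDerivAt (fun y : EuclideanSpace ℝ (Fin n) => y j - x₀ j)
      (EuclideanSpace.proj j : EuclideanSpace ℝ (Fin n) →L[ℝ] ℝ) x :=
      (EuclideanSpace.proj j : EuclideanSpace ℝ (Fin n) →L[ℝ] ℝ).hasFDerivAt.sub_const _
    simpa using h1.pow 2
  refine ⟨∑ j, (2 * (x j - x₀ j)) • (EuclideanSpace.proj j : EuclideanSpace ℝ (Fin n) →L[ℝ] ℝ),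
    ?_, ?_⟩
  · have h2 := HasFDerivAt.fun_sum (u := Finset.univ) fun j _ => hproj j
    have h3 := h2.const_sub ((t₀ - t) ^ 2)
    exact (hasDerivAt_max_zero_sq _).comp_hasFDerivAt x h3
  · intro i
    simp

lemma contDiff_coneProfile_sq (t : ℝ) :
    ContDiff ℝ 1 fun y : EuclideanSpace ℝ (Fin n) => coneProfile t₀ x₀ t y ^ 2 := by
  have h1 : ContDiff ℝ 1 fun s : ℝ => max s 0 ^ 2 := by
    rw [contDiff_one_iff_deriv]
    refine ⟨fun s => (hasDerivAt_max_zero_sq s).differentiableAt, ?_⟩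
    have : deriv (fun s : ℝ => max s 0 ^ 2) = fun s => 2 * max s 0 :=
      funext fun s => (hasDerivAt_max_zero_sq s).deriv
    rw [this]
    fun_prop
  exact h1.comp (by fun_prop :
    ContDiff ℝ 1 fun y : EuclideanSpace ℝ (Fin n) => (t₀ - t) ^ 2 - ∑ j, (y j - x₀ j) ^ 2)

lemma partialDeriv_coneProfile_sq (t : ℝ) (i : Fin n) (x : EuclideanSpace ℝ (Fin n)) :
    partialDeriv (fun y => coneProfile t₀ x₀ t y ^ 2) i x =
      -(4 * (x i - x₀ i)) * coneProfile t₀ x₀ t x := by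
  obtain ⟨L, hL, hLi⟩ := hasFDerivAt_coneProfile_sq (t₀ := t₀) (x₀ := x₀) t x
  rw [partialDeriv, hL.fderiv]
  simp [hLi]
  ring

lemma partialDeriv_mul {f g : EuclideanSpace ℝ (Fin n) → ℝ} {x : EuclideanSpace ℝ (Fin n)}
    (hf : DifferentiableAt ℝ f x) (hg : DifferentiableAt ℝ g x) (i : Fin n) :
    partialDeriv (fun y => f y * g y) i x = partialDeriv f i x * g x + f x * partialDeriv g i x := by
  unfold partialDeriv
  rw [fderiv_fun_mul hf hg]
  simp
  ring

end Cone

/-- The energy flux through the boundary of a light cone is nonnegative. -/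
lemma cone_flux_nonpos {n : ℕ} {r v w : ℝ} {y d : Fin n → ℝ} (hr : 0 ≤ r)
    (hy : ∑ j, y j ^ 2 ≤ r ^ 2) :
    2 * v * ∑ i, y i * d i ≤ r * (v ^ 2 + ∑ i, d i ^ 2 + w ^ 2) := by
  have hcs := Finset.sum_mul_sq_le_sq_mul_sq Finset.univ y d
  set S := ∑ i, y i * d i
  set D := ∑ i, d i ^ 2
  have hD : 0 ≤ D := Finset.sum_nonneg fun _ _ => sq_nonneg _
  have h1 : S ^ 2 ≤ r ^ 2 * D := hcs.trans (mul_le_mul_of_nonneg_right hy hD)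
  have h2 : |S| ≤ r * √D := by
    rw [← Real.sqrt_sq hr, ← Real.sqrt_mul (sq_nonneg r), ← Real.sqrt_sq_eq_abs]
    exact Real.sqrt_le_sqrt h1
  have h3 : v * S ≤ |v| * (r * √D) := by
    refine (le_abs_self _).trans ?_
    rw [abs_mul]
    exact mul_le_mul_of_nonneg_left h2 (abs_nonneg v)
  have h4 : 2 * (|v| * √D) ≤ v ^ 2 + D := by
    nlinarith [sq_nonneg (|v| - √D), Real.sq_sqrt hD, sq_abs v]
  nlinarith [mul_le_mul_of_nonneg_left h4 hr, mul_nonneg hr (sq_nonneg w)]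

/-- The damping has a good sign, the mass coefficient is at most ν² for τ ≥ 1, and |v|^p |v| ≤
M^{p-1} v². The extra + u is the contribution of the term u² in the energy density. -/
lemma reaction_le {μ ν p τ M u v : ℝ} (hμ : 0 ≤ μ) (hp : 1 < p) (hτ : 1 ≤ τ) (hv : |v| ≤ M) :
    2 * v * (-(μ / τ * v) - ν ^ 2 / τ ^ 2 * u + |v| ^ p + u) ≤
      (ν ^ 2 + 1 + 2 * M ^ (p - 1)) * (v ^ 2 + u ^ 2) := by
  have h1 : |v| ^ p * v ≤ M ^ (p - 1) * v ^ 2 := by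
    have : |v| ^ p = |v| ^ (p - 1) * |v| := by
      conv_lhs => rw [show p = (p - 1) + 1 by ring]
      rw [Real.rpow_add_one' (abs_nonneg v) (by linarith)]
    have h2 : |v| ^ (p - 1) ≤ M ^ (p - 1) :=
      Real.rpow_le_rpow (abs_nonneg v) hv (by linarith)
    calc |v| ^ p * v ≤ |v| ^ p * |v| := mul_le_mul_of_nonneg_left (le_abs_self v) (by positivity)
      _ = |v| ^ (p - 1) * v ^ 2 := by rw [this, mul_assoc, ← sq, sq_abs]
      _ ≤ _ := mul_le_mul_of_nonneg_right h2 (sq_nonneg v)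
  have h2 : 0 ≤ μ / τ * v ^ 2 := by positivity
  have h3 : ν ^ 2 / τ ^ 2 ≤ ν ^ 2 := div_le_self (sq_nonneg ν) (by nlinarith)
  have h3' : 0 ≤ ν ^ 2 / τ ^ 2 := by positivity
  have h4 : -(2 * (u * v)) ≤ u ^ 2 + v ^ 2 := by nlinarith [sq_nonneg (u + v)]
  have h5 : 2 * (u * v) ≤ u ^ 2 + v ^ 2 := by nlinarith [sq_nonneg (u - v)]
  have h6 : ν ^ 2 / τ ^ 2 * (-(2 * (u * v))) ≤ ν ^ 2 * (u ^ 2 + v ^ 2) :=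
    (mul_le_mul_of_nonneg_left h4 h3').trans (mul_le_mul_of_nonneg_right h3 (by positivity))
  have hM : 0 ≤ M ^ (p - 1) := Real.rpow_nonneg ((abs_nonneg v).trans hv) _
  nlinarith [mul_nonneg hM (sq_nonneg u)]

/-! ### Weighted energy estimate in a light cone -/

section Energy

variable {n : ℕ}

/-- The energy density `u_t² + |∇u|² + u²`. -/
def energyDensity (u : ℝ → EuclideanSpace ℝ (Fin n) → ℝ) (t : ℝ)
    (x : EuclideanSpace ℝ (Fin n)) : ℝ :=
  velocity u t x ^ 2 + ∑ i, partialDeriv (u t) i x ^ 2 + u t x ^ 2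

lemma energyDensity_nonneg (u : ℝ → EuclideanSpace ℝ (Fin n) → ℝ)
    (t : ℝ) (x : EuclideanSpace ℝ (Fin n)) : 0 ≤ energyDensity u t x := by
  have : 0 ≤ ∑ i, partialDeriv (u t) i x ^ 2 := Finset.sum_nonneg fun _ _ => sq_nonneg _
  unfold energyDensity
  positivity

/-- The time derivative of the weighted energy density. -/
def energyRate (t₀ : ℝ) (x₀ : EuclideanSpace ℝ (Fin n))
    (u : ℝ → EuclideanSpace ℝ (Fin n) → ℝ) (t : ℝ) (x : EuclideanSpace ℝ (Fin n)) : ℝ :=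
  -(4 * (t₀ - t)) * coneProfile t₀ x₀ t x * energyDensity u t x +
    coneProfile t₀ x₀ t x ^ 2 * (2 * velocity u t x * deriv (fun s => velocity u s x) t +
      ∑ i, 2 * partialDeriv (u t) i x * partialDeriv (velocity u t) i x +
      2 * u t x * velocity u t x)

end Energy

namespace IsSolution

variable {n : ℕ} {μ ν p ε : ℝ} {u₀ u₁ : EuclideanSpace ℝ (Fin n) → ℝ} {T : EReal}
  {u : ℝ → EuclideanSpace ℝ (Fin n) → ℝ}

lemma continuousOn_energyDensity (h : IsSolution μ ν p ε u₀ u₁ T u) :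
    ContinuousOn (fun q : ℝ × EuclideanSpace ℝ (Fin n) => energyDensity u q.1 q.2)
      (timeIco T ×ˢ univ) :=
  ((h.continuousOn_velocity.pow 2).add
    (continuousOn_finsetSum _ fun i _ => (h.continuousOn_partialDeriv i).pow 2)).add
    (h.continuousOn.pow 2)

lemma hasDerivAt_energy (h : IsSolution μ ν p ε u₀ u₁ T u) {t : ℝ} (ht : t ∈ timeIoo T)
    (t₀ : ℝ) (x₀ x : EuclideanSpace ℝ (Fin n)) :
    HasDerivAt (fun s => coneProfile t₀ x₀ s x ^ 2 * energyDensity u s x)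
      (energyRate t₀ x₀ u t x) t := by
  have h1 : HasDerivAt (fun s => energyDensity u s x)
      (2 * velocity u t x * deriv (fun s => velocity u s x) t +
      ∑ i, 2 * partialDeriv (u t) i x * partialDeriv (velocity u t) i x +
      2 * u t x * velocity u t x) t := by
    have a1 := (h.hasDerivAt_deriv_velocity ht x).pow 2
    have a2 := HasDerivAt.fun_sum (u := Finset.univ)
      fun i _ => (h.hasDerivAt_partialDeriv ht i x).pow 2
    have a3 := (h.hasDerivAt_velocity ht x).pow 2
    refine ((a1.add a2).add a3).congr_deriv ?_
    simp
  exact (hasDerivAt_coneProfile_sq t x).mul h1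

lemma continuousOn_energyRate (h : IsSolution μ ν p ε u₀ u₁ T u) (t₀ : ℝ)
    (x₀ : EuclideanSpace ℝ (Fin n)) :
    ContinuousOn (fun q : ℝ × EuclideanSpace ℝ (Fin n) => energyRate t₀ x₀ u q.1 q.2)
      (timeIoo T ×ˢ univ) := by
  have hsub : timeIoo T ×ˢ (univ : Set (EuclideanSpace ℝ (Fin n))) ⊆ timeIco T ×ˢ univ :=
    prod_mono (timeIoo_subset_timeIco T) le_rfl
  have hv := h.continuousOn_velocity.mono hsub
  have hu := h.continuousOn.mono hsub
  have hd := fun i => (h.continuousOn_partialDeriv i).mono hsub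
  have he := h.continuousOn_energyDensity.mono hsub
  have ha := h.continuousOn_deriv_velocity
  have hb := h.continuousOn_partialDeriv_velocity
  have hc : ContinuousOn (fun q : ℝ × EuclideanSpace ℝ (Fin n) => coneProfile t₀ x₀ q.1 q.2)
      (timeIoo T ×ˢ univ) := continuous_coneProfile.continuousOn
  refine ContinuousOn.add (ContinuousOn.mul (ContinuousOn.mul (by fun_prop) hc) he)
    ((hc.pow 2).mul ?_)
  refine ContinuousOn.add (ContinuousOn.add ((continuousOn_const.mul hv).mul ha) ?_)
    ((continuousOn_const.mul hu).mul hv)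
  exact continuousOn_finsetSum _ fun i _ => (continuousOn_const.mul (hd i)).mul (hb i)

/-- Up to a divergence, the energy rate is controlled by the energy density. -/
lemma energyRate_sub_divergence_le (h : IsSolution μ ν p ε u₀ u₁ T u) (hμ : 0 ≤ μ) (hp : 1 < p)
    {t t₀ M : ℝ} (ht : t ∈ timeIoo T) (ht₀ : t ≤ t₀) (x₀ x : EuclideanSpace ℝ (Fin n))
    (hM : x ∈ Metric.closedBall x₀ t₀ → |velocity u t x| ≤ M) :
    energyRate t₀ x₀ u t x - ∑ i, 2 * partialDeriv (fun y => coneProfile t₀ x₀ t y ^ 2 *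
        velocity u t y * partialDeriv (u t) i y) i x ≤
      (ν ^ 2 + 1 + 2 * M ^ (p - 1)) * (coneProfile t₀ x₀ t x ^ 2 * energyDensity u t x) := by
  have hdv := (h.contDiff_slice_velocity ht).differentiable one_ne_zero
  have hdd := fun i => (h.contDiff_slice_partialDeriv ht i).differentiable one_ne_zero
  have hdc := (contDiff_coneProfile_sq (t₀ := t₀) (x₀ := x₀) t).differentiable one_ne_zero
  have hdiv : ∀ i, partialDeriv (fun y => coneProfile t₀ x₀ t y ^ 2 *
        velocity u t y * partialDeriv (u t) i y) i x =
      (-(4 * (x i - x₀ i)) * coneProfile t₀ x₀ t x * velocity u t x +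
        coneProfile t₀ x₀ t x ^ 2 * partialDeriv (velocity u t) i x) * partialDeriv (u t) i x +
      coneProfile t₀ x₀ t x ^ 2 * velocity u t x * partialDeriv (partialDeriv (u t) i) i x := by
    intro i
    rw [partialDeriv_mul ((hdc x).fun_mul (hdv x)) (hdd i x), partialDeriv_mul (hdc x) (hdv x),
      partialDeriv_coneProfile_sq]
  simp only [hdiv, energyRate, h.deriv_velocity_eq ht x]
  set c := coneProfile t₀ x₀ t x with hc
  set v := velocity u t x
  -- Where c > 0 the point lies inside the cone, so |x - x₀| ≤ t₀ - t. The shrinking of the cutoff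
  -- then pays for the flux.
  have hflux : c * (2 * v * ∑ i, (x i - x₀ i) * partialDeriv (u t) i x) ≤
      c * ((t₀ - t) * energyDensity u t x) := by
    rcases (coneProfile_nonneg (t₀ := t₀) (x₀ := x₀) t x).eq_or_lt with h0 | h0
    · rw [hc, ← h0]; simp
    · refine mul_le_mul_of_nonneg_left (cone_flux_nonpos (by linarith) ?_) h0.le
      by_contra! hcon
      have : coneProfile t₀ x₀ t x = 0 := max_eq_right (by linarith)
      linarith
  have hreac : c ^ 2 * (2 * v * (-(μ / (1 + t) * v) - ν ^ 2 / (1 + t) ^ 2 * u t x + |v| ^ p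
      + u t x)) ≤ c ^ 2 * ((ν ^ 2 + 1 + 2 * M ^ (p - 1)) * energyDensity u t x) := by
    by_cases hx : x ∈ Metric.closedBall x₀ t₀
    · refine mul_le_mul_of_nonneg_left ?_ (sq_nonneg c)
      refine (reaction_le hμ hp (by linarith [ht.1]) (hM hx)).trans ?_
      have hM0 : 0 ≤ M ^ (p - 1) := Real.rpow_nonneg ((abs_nonneg _).trans (hM hx)) _
      refine mul_le_mul_of_nonneg_left ?_ (by positivity)
      have : 0 ≤ ∑ i, partialDeriv (u t) i x ^ 2 := Finset.sum_nonneg fun _ _ => sq_nonneg _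
      simp only [energyDensity]
      linarith
    · rw [hc, coneProfile_eq_zero ht.1.le ht₀ hx]
      simp
  have hsum : ∑ i, 2 * ((-(4 * (x i - x₀ i)) * c * v + c ^ 2 * partialDeriv (velocity u t) i x) *
      partialDeriv (u t) i x + c ^ 2 * v * partialDeriv (partialDeriv (u t) i) i x) =
      -4 * (c * (2 * v * ∑ i, (x i - x₀ i) * partialDeriv (u t) i x)) +
      c ^ 2 * ∑ i, 2 * partialDeriv (u t) i x * partialDeriv (velocity u t) i x +
      c ^ 2 * (2 * v * ∑ i, partialDeriv (partialDeriv (u t) i) i x) := by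
    simp only [Finset.mul_sum, ← Finset.sum_add_distrib]
    exact Finset.sum_congr rfl fun i _ => by ring
  rw [hsum]
  linarith

/-- Grönwall's inequality for the energy weighted by the squared cutoff: divergences integrate to
zero because the cutoff is compactly supported, and the nonlinearity is linearly bounded because u_t
is bounded on the compact cone region. A vanishing integral of a continuous nonnegative function
forces it to vanish at x₀, where the cutoff is positive. -/
lemma energy_eq_zero (h : IsSolution μ ν p ε u₀ u₁ T u) (hμ : 0 ≤ μ) (hp : 1 < p)
    {b t₀ : ℝ} (hb : b ∈ timeIco T) (hbt : b < t₀) (x₀ : EuclideanSpace ℝ (Fin n))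
    (h0 : ∀ x ∈ Metric.closedBall x₀ t₀, energyDensity u 0 x = 0) :
    energyDensity u b x₀ = 0 := by
  set K := Metric.closedBall x₀ t₀
  have hK : IsCompact K := isCompact_closedBall x₀ t₀
  have hIcc : Icc 0 b ⊆ timeIco T := fun t ht =>
    ⟨ht.1, lt_of_le_of_lt (EReal.coe_le_coe_iff.2 ht.2) hb.2⟩
  have hIoo : Ioo 0 b ⊆ timeIoo T := fun t ht => ⟨ht.1, (hIcc ⟨ht.1.le, ht.2.le⟩).2⟩
  obtain ⟨M, hM⟩ := (isCompact_Icc.prod hK).exists_bound_of_continuousOn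
    (h.continuousOn_velocity.mono (prod_mono hIcc (subset_univ K)))
  set F : ℝ → EuclideanSpace ℝ (Fin n) → ℝ :=
    fun t x => coneProfile t₀ x₀ t x ^ 2 * energyDensity u t x with hF
  have hFc : ContinuousOn (fun q : ℝ × EuclideanSpace ℝ (Fin n) => F q.1 q.2)
      (Icc 0 b ×ˢ univ) :=
    (continuous_coneProfile.continuousOn.pow 2).mul
      (h.continuousOn_energyDensity.mono (prod_mono hIcc le_rfl))
  have hF0 : ∀ t ∈ Icc 0 b, ∀ x ∉ K, F t x = 0 := fun t ht x hx => by
    simp [hF, coneProfile_eq_zero ht.1 (ht.2.trans hbt.le) hx]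
  have hFint : ∀ t ∈ Icc 0 b, Integrable (F t) := fun t ht =>
    integrable_of_continuous_of_eq_zero hK (continuous_slice hFc ht) (hF0 t ht)
  have hder := fun t (ht : t ∈ Ioo 0 b) => hasDerivAt_integral_of_compact_support isOpen_Ioo hK
    (hFc.mono (prod_mono Ioo_subset_Icc_self le_rfl))
    ((h.continuousOn_energyRate t₀ x₀).mono (prod_mono hIoo le_rfl))
    (fun r hr x => h.hasDerivAt_energy (hIoo hr) t₀ x₀ x)
    (fun r hr x hx => hF0 r (Ioo_subset_Icc_self hr) x hx) ht
  set C := ν ^ 2 + 1 + 2 * M ^ (p - 1)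
  have hle : ∀ t ∈ Ioo 0 b, ∫ x, energyRate t₀ x₀ u t x ≤ C * ∫ x, F t x := by
    intro t ht
    have hdiv := fun i => integral_fderiv_apply_eq_zero hK
      (f := fun y => coneProfile t₀ x₀ t y ^ 2 * velocity u t y * partialDeriv (u t) i y)
      (((contDiff_coneProfile_sq t).mul (h.contDiff_slice_velocity (hIoo ht))).mul
        (h.contDiff_slice_partialDeriv (hIoo ht) i))
      (fun x hx => by simp [coneProfile_eq_zero ht.1.le (ht.2.le.trans hbt.le) hx])
      (EuclideanSpace.single i 1)
    have hint : ∀ i, Integrable fun x => 2 * partialDeriv (fun y => coneProfile t₀ x₀ t y ^ 2 *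
        velocity u t y * partialDeriv (u t) i y) i x := fun i => (hdiv i).1.const_mul 2
    have hzero : ∫ x, ∑ i, 2 * partialDeriv (fun y => coneProfile t₀ x₀ t y ^ 2 *
        velocity u t y * partialDeriv (u t) i y) i x = 0 := by
      rw [integral_finsetSum _ fun i _ => hint i]
      refine Finset.sum_eq_zero fun i _ => ?_
      rw [integral_const_mul]
      unfold partialDeriv at hdiv ⊢
      rw [(hdiv i).2, mul_zero]
    have hsub := integral_sub (hder t ht).1 (integrable_finsetSum Finset.univ fun i _ => hint i)
    rw [hzero, sub_zero] at hsub
    rw [← hsub, ← integral_const_mul]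
    refine integral_mono ((hder t ht).1.sub (integrable_finsetSum Finset.univ fun i _ => hint i))
      ((hFint t (Ioo_subset_Icc_self ht)).const_mul C) fun x => ?_
    exact h.energyRate_sub_divergence_le hμ hp (hIoo ht) (ht.2.le.trans hbt.le) x₀ x
      fun hx => hM (t, x) ⟨Ioo_subset_Icc_self ht, hx⟩
  have hcont : ContinuousOn (fun t => ∫ x, F t x) (Icc 0 b) :=
    continuousOn_integral_of_compact_support hK hFc fun t x ht hx => hF0 t ht x hx
  have hanti : AntitoneOn (fun t => Real.exp (-(C * t)) * ∫ x, F t x) (Icc 0 b) := by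
    have hexp : ∀ t : ℝ, HasDerivAt (fun t => Real.exp (-(C * t))) (-C * Real.exp (-(C * t))) t := by
      intro t
      have := (((hasDerivAt_id t).const_mul C).neg).exp
      refine this.congr_deriv ?_
      simp [mul_comm]
    refine antitoneOn_of_hasDerivWithinAt_nonpos (convex_Icc 0 b)
      (ContinuousOn.mul (by fun_prop) hcont)
      (fun t ht => ((hexp t).mul (hder t (by rwa [interior_Icc] at ht)).2).hasDerivWithinAt) ?_
    intro t ht
    rw [interior_Icc] at ht
    have := mul_le_mul_of_nonneg_left (hle t ht) (Real.exp_pos (-(C * t))).le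
    linarith
  have hb0 : (0 : ℝ) ∈ Icc 0 b := ⟨le_rfl, hb.1⟩
  have hbb : b ∈ Icc 0 b := ⟨hb.1, le_rfl⟩
  have hFnn : ∀ t x, 0 ≤ F t x := fun t x =>
    mul_nonneg (sq_nonneg _) (energyDensity_nonneg u t x)
  have hstart : ∫ x, F 0 x = 0 := by
    have : F 0 = fun _ => 0 := by
      funext x
      by_cases hx : x ∈ K
      · simp [hF, h0 x hx]
      · exact hF0 0 hb0 x hx
    rw [this]
    simp
  have hfin : ∫ x, F b x = 0 := by
    have h1 := hanti hb0 hbb hb.1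
    simp only [hstart, mul_zero] at h1
    refine le_antisymm ?_ (integral_nonneg (hFnn b))
    exact nonpos_of_mul_nonpos_right h1 (Real.exp_pos _)
  have hae := (integral_eq_zero_iff_of_nonneg (hFnn b) (hFint b hbb)).1 hfin
  have hz : F b = 0 := (continuous_slice hFc hbb).ae_eq_iff_eq volume continuous_const |>.1 hae
  have h1 : F b x₀ = 0 := congrFun hz x₀
  have h2 : coneProfile t₀ x₀ b x₀ ^ 2 ≠ 0 := by
    have : coneProfile t₀ x₀ b x₀ = (t₀ - b) ^ 2 := by
      simp [coneProfile, sq_nonneg]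
    rw [this]
    have : 0 < t₀ - b := by linarith
    positivity
  exact (mul_eq_zero.1 h1).resolve_left h2

/-- Finite speed of propagation. -/
theorem eq_zero_of_lt_norm (h : IsSolution μ ν p ε u₀ u₁ T u) (hμ : 0 ≤ μ) (hp : 1 < p) {R : ℝ}
    (hsupp₀ : tsupport u₀ ⊆ Metric.closedBall 0 R) (hsupp₁ : tsupport u₁ ⊆ Metric.closedBall 0 R)
    {t : ℝ} (ht : t ∈ timeIco T) {x : EuclideanSpace ℝ (Fin n)} (hx : R + t < ‖x‖) :
    u t x = 0 ∧ velocity u t x = 0 := by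
  have key : energyDensity u t x = 0 := by
    -- The midpoint of t and ‖x‖ - R exceeds t, while the ball of this radius about x still misses
    -- the ball of radius R about 0.
    refine h.energy_eq_zero hμ hp (t₀ := (t + (‖x‖ - R)) / 2) ht (by linarith) x ?_
    intro y hy
    have hy' : R < ‖y‖ := by
      rw [Metric.mem_closedBall, dist_eq_norm, ← norm_neg, neg_sub] at hy
      have := norm_sub_norm_le x y
      linarith
    have hball : ∀ z : EuclideanSpace ℝ (Fin n), R < ‖z‖ → z ∉ Metric.closedBall 0 R := by
      intro z hz; simpa using hz
    have e0 : ∀ z, R < ‖z‖ → u 0 z = 0 := fun z hz => by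
      rw [h.initial_value, image_eq_zero_of_notMem_tsupport fun hm => hball z hz (hsupp₀ hm),
        mul_zero]
    have e1 : velocity u 0 y = 0 := by
      rw [h.velocity_zero, image_eq_zero_of_notMem_tsupport fun hm => hball y hy' (hsupp₁ hm),
        mul_zero]
    have e2 : ∀ i, partialDeriv (u 0) i y = 0 := by
      intro i
      have : u 0 =ᶠ[𝓝 y] fun _ => 0 := by
        filter_upwards [(isOpen_lt continuous_const continuous_norm).mem_nhds hy'] with z hz
        exact e0 z hz
      rw [partialDeriv, this.fderiv_eq]
      simp
    simp [energyDensity, e0 y hy', e1, e2]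
  have hs : 0 ≤ ∑ i, partialDeriv (u t) i x ^ 2 := Finset.sum_nonneg fun _ _ => sq_nonneg _
  unfold energyDensity at key
  constructor
  · nlinarith [sq_nonneg (velocity u t x), sq_nonneg (u t x)]
  · nlinarith [sq_nonneg (velocity u t x), sq_nonneg (u t x)]

end IsSolution

/-! ### The averaged equation -/

lemma one_add_rpow_hasDerivAt {t : ℝ} (ht : 0 ≤ t) (a : ℝ) :
    HasDerivAt (fun s : ℝ => (1 + s) ^ a) (a / (1 + t) * (1 + t) ^ a) t := by
  have h1 : HasDerivAt (fun s : ℝ => 1 + s) 1 t := by simpa using (hasDerivAt_id t).const_add 1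
  refine (h1.rpow_const (p := a) (Or.inl (by positivity))).congr_deriv ?_
  rw [Real.rpow_sub_one (by positivity)]
  ring

/-- Growth of solutions of `W'' + μ / (1 + t) W' + (ν² / (1 + t)² - 1) W = N` with `N ≥ 0`, in terms
of the Liouville transform of `W`. -/
lemma damped_equation_growth {μ ν b : ℝ} {W V N : ℝ → ℝ} (hμ : 0 ≤ μ) (hδ : 0 ≤ delta μ ν)
    (hW : ContinuousOn W (Icc 0 b)) (hV : ContinuousOn V (Icc 0 b))
    (hdW : ∀ t ∈ Ioo 0 b, HasDerivAt W (V t) t)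
    (hdV : ∀ t ∈ Ioo 0 b,
      HasDerivAt V (N t - μ / (1 + t) * V t - ν ^ 2 / (1 + t) ^ 2 * W t + W t) t)
    (hN : ∀ t ∈ Ioo 0 b, 0 ≤ N t) (hW0 : 0 ≤ W 0) (hV0 : 0 ≤ V 0) :
    ∃ G G' : ℝ → ℝ, ContinuousOn G (Icc 0 b) ∧
      (∀ t ∈ Ioo 0 b, HasDerivAt G (G' t) t ∧
        Real.exp (-(1 / 4)) * Real.exp (-t) * ((1 + t) ^ (μ / 2) * N t) ≤ G' t) ∧
      (∀ t ∈ Icc 0 b, Real.exp (-(1 / 4)) * ((1 + μ / 2) * W 0 + V 0) ≤ G t) ∧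
      ∀ t ∈ Icc 0 b, 1 ≤ t → 4 * μ ≤ t →
        Real.exp t * G t ≤ 8 * ((1 + t) ^ (μ / 2) * V t) := by
  set w : ℝ → ℝ := fun t => (1 + t) ^ (μ / 2) * W t with hw
  set w' : ℝ → ℝ := fun t => (1 + t) ^ (μ / 2) * (V t + μ / 2 / (1 + t) * W t) with hw'
  set f : ℝ → ℝ := fun t => (1 + t) ^ (μ / 2) * N t with hf
  have hpos : ∀ t ∈ Icc 0 b, 0 < 1 + t := fun t ht => by linarith [ht.1]
  have hr : ContinuousOn (fun t : ℝ => (1 + t) ^ (μ / 2)) (Icc 0 b) :=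
    ContinuousOn.rpow_const (by fun_prop) fun t ht => Or.inl (hpos t ht).ne'
  have hwc : ContinuousOn w (Icc 0 b) := hr.mul hW
  have hwc' : ContinuousOn w' (Icc 0 b) := by
    refine hr.mul (hV.add (ContinuousOn.mul (continuousOn_const.div (by fun_prop) ?_) hW))
    exact fun t ht => (hpos t ht).ne'
  have hd : ∀ t ∈ Ioo 0 b, HasDerivAt w (w' t) t := by
    intro t ht
    refine ((one_add_rpow_hasDerivAt ht.1.le (μ / 2)).mul (hdW t ht)).congr_deriv ?_
    simp only [hw']
    ring
  have hd' : ∀ t ∈ Ioo 0 b,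
      HasDerivAt w' ((1 + (delta μ ν - 1) / 4 / (1 + t) ^ 2) * w t + f t) t := by
    intro t ht
    have h1 : HasDerivAt (fun s : ℝ => μ / 2 / (1 + s)) (-(μ / 2) / (1 + t) ^ 2) t := by
      have h2 : HasDerivAt (fun s : ℝ => 1 + s) 1 t := by
        simpa using (hasDerivAt_id t).const_add 1
      simpa using (hasDerivAt_const t (μ / 2)).fun_div h2 (by linarith [ht.1])
    refine ((one_add_rpow_hasDerivAt ht.1.le (μ / 2)).mul
      ((hdV t ht).add (h1.mul (hdW t ht)))).congr_deriv ?_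
    have h3 : 1 + t ≠ 0 := by linarith [ht.1]
    simp only [hw, hf, delta, Pi.add_apply, Pi.mul_apply]
    field_simp
    ring
  have hfn : ∀ t ∈ Ioo 0 b, 0 ≤ f t := fun t ht =>
    mul_nonneg (Real.rpow_nonneg (by linarith [ht.1]) _) (hN t ht)
  have h0 : w 0 = W 0 := by simp [hw]
  have h0' : w' 0 = V 0 + μ / 2 * W 0 := by simp [hw']
  have hw0 : 0 ≤ w 0 := by rwa [h0]
  have hw0' : 0 ≤ w' 0 := by rw [h0']; positivity
  -- The only use of δ ≥ 0.
  have hκ : -(1 / 4) ≤ (delta μ ν - 1) / 4 := by linarith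
  obtain ⟨⟨G', hG'⟩, hge⟩ := inverse_square_equation_growth hκ hwc hwc' hd hd' hfn hw0 hw0'
  refine ⟨growth w w', G', continuousOn_growth hwc hwc', hG', ?_, ?_⟩
  · intro t ht
    have hmono := monotoneOn_Icc_of_hasDerivAt_nonneg (continuousOn_growth hwc hwc')
      (fun t ht => (hG' t ht).1) fun t ht =>
        (mul_nonneg (by positivity) (hfn t ht)).trans (hG' t ht).2
    have h1 := hmono ⟨le_rfl, ht.1.trans ht.2⟩ ht ht.1
    refine le_trans (le_of_eq ?_) h1
    simp only [growth, h0, h0']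
    norm_num
    ring
  · intro t ht ht1 htμ
    refine (hge t ht ht1).trans ?_
    have hWt := (nonneg_of_inverse_square_equation hκ hwc hwc' hd hd' hfn hw0 hw0' t ht).1
    -- For t ≥ 4μ the term by which w' differs from (1+t)^{μ/2} V is at most w/8; this is why growth
    -- was established for w' - w/8.
    have h1 : μ / 2 / (1 + t) ≤ 1 / 8 := by
      rw [div_le_iff₀ (hpos t ht)]
      linarith
    have h2 : w' t = (1 + t) ^ (μ / 2) * V t + μ / 2 / (1 + t) * w t := by
      simp only [hw, hw']
      ring
    have h3 := mul_le_mul_of_nonneg_right h1 hWt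
    rw [h2]
    linarith

/-! ### Averages against the exponential weight -/

section Average

variable {n : ℕ}

/-- The spatial average of `f` against the exponential weight. -/
def weightedAverage (i : Fin n) (f : EuclideanSpace ℝ (Fin n) → ℝ) : ℝ :=
  ∫ x, f x * expWeight i x

lemma contDiff_expWeight (i : Fin n) : ContDiff ℝ 1 (expWeight i) := by
  unfold expWeight
  fun_prop

lemma partialDeriv_expWeight (i j : Fin n) (x : EuclideanSpace ℝ (Fin n)) :
    partialDeriv (expWeight i) j x = (if j = i then 1 else 0) * expWeight i x := by
  have h1 : HasFDerivAt (fun y : EuclideanSpace ℝ (Fin n) => y i)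
      (EuclideanSpace.proj i : EuclideanSpace ℝ (Fin n) →L[ℝ] ℝ) x :=
    (EuclideanSpace.proj i : EuclideanSpace ℝ (Fin n) →L[ℝ] ℝ).hasFDerivAt
  have h2 : HasFDerivAt (expWeight i) _ x := h1.exp
  rw [partialDeriv, h2.fderiv]
  simp [expWeight, eq_comm]

/-- Green's identity: (Δf - f) ω is the divergence of the field with components (∂_j f - c_j f) ω,
where c is the i-th unit vector and ∂_j ω = c_j ω. -/
lemma weightedAverage_laplacian (i : Fin n) {f : EuclideanSpace ℝ (Fin n) → ℝ}
    (hf : ContDiff ℝ 1 f) (hf' : ∀ j, ContDiff ℝ 1 (partialDeriv f j)) {K : Set _}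
    (hK : IsCompact K) (h0 : ∀ x ∉ K, f x = 0) :
    Integrable (fun x => (∑ j, partialDeriv (partialDeriv f j) j x) * expWeight i x) ∧
    weightedAverage i (fun x => ∑ j, partialDeriv (partialDeriv f j) j x) =
      weightedAverage i f := by
  set c : Fin n → ℝ := fun j => if j = i then 1 else 0 with hc
  have h0' : ∀ j, ∀ x ∉ K, partialDeriv f j x = 0 := by
    intro j x hx
    have : f =ᶠ[𝓝 x] fun _ => 0 := by
      filter_upwards [hK.isClosed.isOpen_compl.mem_nhds hx] with y hy
      exact h0 y hy
    rw [partialDeriv, this.fderiv_eq]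
    simp
  have hfi : Integrable fun x => f x * expWeight i x :=
    integrable_of_continuous_of_eq_zero hK (hf.continuous.mul (continuous_expWeight i))
      fun x hx => by simp [h0 x hx]
  have hdiv := fun j => integral_fderiv_apply_eq_zero hK
    (f := fun x => (partialDeriv f j x - c j * f x) * expWeight i x)
    (((hf' j).sub (contDiff_const.mul hf)).mul (contDiff_expWeight i))
    (fun x hx => by simp [h0 x hx, h0' j x hx]) (EuclideanSpace.single j 1)
  have hpd : ∀ j x, fderiv ℝ (fun x => (partialDeriv f j x - c j * f x) * expWeight i x) x
      (EuclideanSpace.single j 1) =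
      partialDeriv (partialDeriv f j) j x * expWeight i x - c j * (f x * expWeight i x) := by
    intro j x
    have d1 := (hf' j).differentiable one_ne_zero x
    have d2 := hf.differentiable one_ne_zero x
    have d3 : partialDeriv (fun x => partialDeriv f j x - c j * f x) j x =
        partialDeriv (partialDeriv f j) j x - c j * partialDeriv f j x := by
      have := (d1.hasFDerivAt.sub (d2.hasFDerivAt.const_mul (c j))).fderiv
      have e : (fun x => partialDeriv f j x - c j * f x) =
        (partialDeriv f j - fun x => c j * f x) := rfl
      rw [partialDeriv, e, this]
      simp [partialDeriv]
    have := partialDeriv_mul (d1.fun_sub (d2.const_mul (c j)))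
      ((contDiff_expWeight i).differentiable one_ne_zero x) j
    rw [partialDeriv] at this
    rw [this, d3, partialDeriv_expWeight]
    by_cases hji : j = i
    · simp [hc, hji]; ring
    · simp [hc, hji]
  have hpt : ∀ x, (∑ j, partialDeriv (partialDeriv f j) j x) * expWeight i x =
      ∑ j, fderiv ℝ (fun x => (partialDeriv f j x - c j * f x) * expWeight i x) x
      (EuclideanSpace.single j 1) + f x * expWeight i x := by
    intro x
    simp only [hpd, Finset.sum_sub_distrib, ← Finset.sum_mul]
    simp [hc]
  have hsum := integrable_finsetSum Finset.univ fun j _ => (hdiv j).1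
  unfold weightedAverage
  simp only [hpt]
  refine ⟨hsum.add hfi, ?_⟩
  rw [integral_add hsum hfi, integral_finsetSum _ fun j _ => (hdiv j).1,
    Finset.sum_eq_zero fun j _ => (hdiv j).2, zero_add]

/-- Jensen's inequality for the exponential weight on a ball. -/
lemma weightedAverage_rpow_le (i : Fin n) {f : EuclideanSpace ℝ (Fin n) → ℝ} {p r : ℝ}
    (hp : 1 < p) (hr : 0 < r) (hf : Continuous f) (h0 : ∀ x ∉ Metric.closedBall 0 r, f x = 0)
    (hpos : 0 < weightedAverage i f) :
    weightedAverage i f ^ p ≤ weightedAverage i (fun x => |f x| ^ p) *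
      (∫ x in Metric.closedBall (0 : EuclideanSpace ℝ (Fin n)) r, expWeight i x) ^ (p - 1) := by
  set B := Metric.closedBall (0 : EuclideanSpace ℝ (Fin n)) r with hB
  have hBc : IsCompact B := isCompact_closedBall _ _
  set A := ∫ x in B, expWeight i x with hA
  set V := weightedAverage i f with hV
  have hωi : IntegrableOn (expWeight i) B :=
    (continuous_expWeight i).continuousOn.integrableOn_compact hBc
  have hApos : 0 < A := by
    rw [hA, setIntegral_pos_iff_support_of_nonneg_ae
      (Filter.Eventually.of_forall fun x => (expWeight_pos i x).le) hωi]
    have : Function.support (expWeight i) = univ := by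
      ext x; simp [(expWeight_pos i x).ne']
    rw [this, univ_inter]
    exact Metric.measure_closedBall_pos _ _ hr
  have hfi : Integrable fun x => f x * expWeight i x :=
    integrable_of_continuous_of_eq_zero hBc (hf.mul (continuous_expWeight i))
      fun x hx => by simp [h0 x hx]
  have hpi : Integrable fun x => |f x| ^ p * expWeight i x :=
    integrable_of_continuous_of_eq_zero hBc
      ((hf.abs.rpow_const fun x => Or.inr (by linarith)).mul (continuous_expWeight i))
      fun x hx => by simp [h0 x hx, Real.zero_rpow (by linarith : p ≠ 0)]
  set l := V / A with hl
  have hlpos : 0 < l := div_pos hpos hApos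
  -- The tangent line to s^p at the mean l, obtained from Bernoulli's inequality. Since y ≤ |y|, f
  -- may change sign as long as its mean is positive.
  have htan : ∀ y : ℝ, p * l ^ (p - 1) * y - (p - 1) * l ^ p ≤ |y| ^ p := by
    intro y
    have h1 := one_add_mul_self_le_rpow_one_add (s := |y| / l - 1)
      (by have : 0 ≤ |y| / l := by positivity
          linarith) hp.le
    rw [add_sub_cancel, Real.div_rpow (abs_nonneg y) hlpos.le, le_div_iff₀ (by positivity)] at h1
    have h2 : l ^ p = l ^ (p - 1) * l := by
      conv_lhs => rw [show p = (p - 1) + 1 by ring]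
      rw [Real.rpow_add_one hlpos.ne']
    have h3 : |y| / l * l = |y| := div_mul_cancel₀ _ hlpos.ne'
    have h4 : (1 + p * (|y| / l - 1)) * l ^ p = p * l ^ (p - 1) * |y| - (p - 1) * l ^ p := by
      rw [h2]
      linear_combination (p * l ^ (p - 1)) * h3
    have h5 : p * l ^ (p - 1) * y ≤ p * l ^ (p - 1) * |y| :=
      mul_le_mul_of_nonneg_left (le_abs_self y) (by positivity)
    linarith
  have hind : Integrable (B.indicator (expWeight i)) :=
    (integrable_indicator_iff hBc.measurableSet).2 hωi
  have hmain : p * l ^ (p - 1) * V - (p - 1) * l ^ p * A ≤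
      weightedAverage i fun x => |f x| ^ p := by
    have e1 : p * l ^ (p - 1) * V - (p - 1) * l ^ p * A =
        ∫ x, (p * l ^ (p - 1) * (f x * expWeight i x) -
          (p - 1) * l ^ p * B.indicator (expWeight i) x) := by
      rw [integral_sub (hfi.const_mul _) (hind.const_mul _), integral_const_mul,
        integral_const_mul, integral_indicator hBc.measurableSet]
      rfl
    rw [e1]
    refine integral_mono ((hfi.const_mul _).sub (hind.const_mul _)) hpi fun x => ?_
    by_cases hx : x ∈ B
    · simp only [indicator_of_mem hx]
      have := mul_le_mul_of_nonneg_right (htan (f x)) (expWeight_pos i x).le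
      linarith
    · simp [hx, h0 x hx, Real.zero_rpow (by linarith : p ≠ 0)]
  have e2 : p * l ^ (p - 1) * V - (p - 1) * l ^ p * A = l ^ (p - 1) * V := by
    have h2 : l ^ p = l ^ (p - 1) * l := by
      conv_lhs => rw [show p = (p - 1) + 1 by ring]
      rw [Real.rpow_add_one hlpos.ne']
    have h3 : l * A = V := div_mul_cancel₀ _ hApos.ne'
    rw [h2, ← h3]; ring
  rw [e2] at hmain
  have e3 : V ^ p = l ^ (p - 1) * V * A ^ (p - 1) := by
    have h1 : l ^ (p - 1) * A ^ (p - 1) = V ^ (p - 1) := by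
      rw [← Real.mul_rpow hlpos.le hApos.le, div_mul_cancel₀ _ hApos.ne']
    conv_lhs => rw [show p = (p - 1) + 1 by ring]
    rw [Real.rpow_add_one hpos.ne', ← h1]; ring
  rw [e3]
  exact mul_le_mul_of_nonneg_right hmain (by positivity)

end Average

namespace IsSolution

variable {n : ℕ} {μ ν p ε : ℝ} {u₀ u₁ : EuclideanSpace ℝ (Fin n) → ℝ} {T : EReal}
  {u : ℝ → EuclideanSpace ℝ (Fin n) → ℝ}

lemma hasDerivAt_weightedAverage (h : IsSolution μ ν p ε u₀ u₁ T u) (i : Fin n) {s : Set ℝ}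
    (hs : IsOpen s) (hsT : s ⊆ timeIoo T) {K : Set (EuclideanSpace ℝ (Fin n))} (hK : IsCompact K)
    (h0 : ∀ t ∈ s, ∀ x ∉ K, u t x = 0) {t : ℝ} (ht : t ∈ s) :
    HasDerivAt (fun t => weightedAverage i (u t)) (weightedAverage i (velocity u t)) t := by
  have hsub := prod_mono (hsT.trans (timeIoo_subset_timeIco T))
    (le_refl (univ : Set (EuclideanSpace ℝ (Fin n))))
  have hω : ContinuousOn (fun q : ℝ × EuclideanSpace ℝ (Fin n) => expWeight i q.2)
      (s ×ˢ univ) := ((continuous_expWeight i).comp continuous_snd).continuousOn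
  exact (hasDerivAt_integral_of_compact_support hs hK
    (F := fun t x => u t x * expWeight i x) (F' := fun t x => velocity u t x * expWeight i x)
    ((h.continuousOn.mono hsub).mul hω) ((h.continuousOn_velocity.mono hsub).mul hω)
    (fun t ht x => (h.hasDerivAt_velocity (hsT ht) x).mul_const _)
    (fun t ht x hx => by simp [h0 t ht x hx]) ht).2

lemma hasDerivAt_weightedAverage_velocity (h : IsSolution μ ν p ε u₀ u₁ T u) (hp : 1 < p)
    (i : Fin n) {s : Set ℝ}
    (hs : IsOpen s) (hsT : s ⊆ timeIoo T) {K : Set (EuclideanSpace ℝ (Fin n))} (hK : IsCompact K)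
    (h0 : ∀ t ∈ s, ∀ x ∉ K, u t x = 0 ∧ velocity u t x = 0) {t : ℝ} (ht : t ∈ s) :
    HasDerivAt (fun t => weightedAverage i (velocity u t))
      (weightedAverage i (fun x => |velocity u t x| ^ p)
        - μ / (1 + t) * weightedAverage i (velocity u t)
        - ν ^ 2 / (1 + t) ^ 2 * weightedAverage i (u t) + weightedAverage i (u t)) t := by
  have hsub := prod_mono (hsT.trans (timeIoo_subset_timeIco T))
    (le_refl (univ : Set (EuclideanSpace ℝ (Fin n))))
  have hω : ContinuousOn (fun q : ℝ × EuclideanSpace ℝ (Fin n) => expWeight i q.2)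
      (s ×ˢ univ) := ((continuous_expWeight i).comp continuous_snd).continuousOn
  have hder := (hasDerivAt_integral_of_compact_support hs hK
    (F := fun t x => velocity u t x * expWeight i x)
    (F' := fun t x => deriv (fun s => velocity u s x) t * expWeight i x)
    ((h.continuousOn_velocity.mono hsub).mul hω)
    ((h.continuousOn_deriv_velocity.mono (prod_mono hsT le_rfl)).mul hω)
    (fun t ht x => (h.hasDerivAt_deriv_velocity (hsT ht) x).mul_const _)
    (fun t ht x hx => by simp [(h0 t ht x hx).2]) ht).2
  refine hder.congr_deriv ?_
  have htT := hsT ht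
  have hcu := (h.contDiff_slice_two htT).continuous
  have hcv := (h.contDiff_slice_velocity htT).continuous
  obtain ⟨hΔi, hΔ⟩ := weightedAverage_laplacian i ((h.contDiff_slice_two htT).of_le (by norm_num))
    (h.contDiff_slice_partialDeriv htT) hK fun x hx => (h0 t ht x hx).1
  have hωc := continuous_expWeight i
  have hui : Integrable fun x => u t x * expWeight i x :=
    integrable_of_continuous_of_eq_zero hK (hcu.mul hωc) fun x hx => by simp [(h0 t ht x hx).1]
  have hvi : Integrable fun x => velocity u t x * expWeight i x :=
    integrable_of_continuous_of_eq_zero hK (hcv.mul hωc) fun x hx => by simp [(h0 t ht x hx).2]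
  have hpi : Integrable fun x => |velocity u t x| ^ p * expWeight i x :=
    integrable_of_continuous_of_eq_zero hK
      ((hcv.abs.rpow_const fun x => Or.inr (by linarith)).mul hωc)
      fun x hx => by simp [(h0 t ht x hx).2, Real.zero_rpow (by linarith : p ≠ 0)]
  have hpt : ∀ x, deriv (fun s => velocity u s x) t * expWeight i x =
      (∑ j, partialDeriv (partialDeriv (u t) j) j x) * expWeight i x
      - μ / (1 + t) * (velocity u t x * expWeight i x)
      - ν ^ 2 / (1 + t) ^ 2 * (u t x * expWeight i x) + |velocity u t x| ^ p * expWeight i x := by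
    intro x
    rw [h.deriv_velocity_eq htT]; ring
  simp only [hpt]
  rw [integral_add ((hΔi.sub' (hvi.const_mul _)).sub' (hui.const_mul _)) hpi,
    integral_sub (hΔi.sub' (hvi.const_mul _)) (hui.const_mul _),
    integral_sub hΔi (hvi.const_mul _), integral_const_mul, integral_const_mul]
  unfold weightedAverage at hΔ ⊢
  rw [hΔ]; ring

/-- The data are arbitrary functions a priori. Continuity is inherited from the solution, and turns
nontriviality into a strictly positive average. -/
lemma continuous_data (h : IsSolution μ ν p ε u₀ u₁ T u) (hε : 0 < ε) :
    Continuous u₀ ∧ Continuous u₁ := by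
  have key : ∀ f g : EuclideanSpace ℝ (Fin n) → ℝ, Continuous f → (∀ x, f x = ε * g x) →
      Continuous g := by
    intro f g hf hfg
    have : g = fun x => ε⁻¹ * f x := by
      funext x; rw [hfg, inv_mul_cancel_left₀ hε.ne']
    rw [this]
    fun_prop
  exact ⟨key _ _ (continuous_slice h.continuousOn h.zero_mem) h.initial_value,
    key _ _ (continuous_slice h.continuousOn_velocity h.zero_mem) h.velocity_zero⟩

end IsSolution

/-! ### Blow-up and the lifespan estimate -/

section

variable {n : ℕ} {μ ν p : ℝ} {u₀ u₁ : EuclideanSpace ℝ (Fin n) → ℝ}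

lemma weightedAverage_nonneg (i : Fin n) {f : EuclideanSpace ℝ (Fin n) → ℝ} (hf : ∀ x, 0 ≤ f x) :
    0 ≤ weightedAverage i f :=
  integral_nonneg fun x => mul_nonneg (hf x) (expWeight_pos i x).le

lemma weightedAverage_pos (i : Fin n) {f : EuclideanSpace ℝ (Fin n) → ℝ} (hc : Continuous f)
    {R : ℝ} (hsupp : tsupport f ⊆ Metric.closedBall 0 R) (hf : ∀ x, 0 ≤ f x) (hne : f ≠ 0) :
    0 < weightedAverage i f := by
  obtain ⟨x, hx⟩ := Function.ne_iff.1 hne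
  refine (hc.mul (continuous_expWeight i)).integral_pos_of_hasCompactSupport_nonneg_nonzero
    (x := x) ?_ (fun y => mul_nonneg (hf y) (expWeight_pos i y).le)
    (mul_ne_zero hx (expWeight_pos i x).ne')
  have hcs : HasCompactSupport f :=
    (isCompact_closedBall _ _).of_isClosed_subset (isClosed_tsupport f) hsupp
  exact hcs.mul_right

/-- The exponentials cancel, -t + pt - (p-1)t = 0, and the powers of 1 + t add up to μ/2 - pμ/2 -
(p-1)m. It is used with m = (n-1)/2. -/
lemma mul_rpow_weights {t μ m p G k : ℝ} (ht : 0 ≤ t) (hG : 0 ≤ G) (hk : 0 < k) :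
    Real.exp (-t) * (1 + t) ^ (μ / 2) *
      ((Real.exp t * G / (8 * (1 + t) ^ (μ / 2))) ^ p / (k * (Real.exp t * (1 + t) ^ m)) ^ (p - 1)) =
    8 ^ (-p) * k ^ (1 - p) * G ^ p * (1 + t) ^ (-((p - 1) * (m + μ / 2))) := by
  have hτ : 0 < 1 + t := by linarith
  rw [Real.div_rpow (by positivity) (by positivity), Real.mul_rpow (by positivity) hG,
    Real.mul_rpow (by positivity) (by positivity), Real.mul_rpow hk.le (by positivity),
    Real.mul_rpow (by positivity) (by positivity), ← Real.exp_mul, ← Real.exp_mul,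
    ← Real.rpow_mul hτ.le, ← Real.rpow_mul hτ.le, Real.rpow_neg (by norm_num : (0 : ℝ) ≤ 8),
    show (1 : ℝ) - p = -(p - 1) by ring, Real.rpow_neg hk.le]
  have h1 : (1 + t) ^ (-((p - 1) * (m + μ / 2))) =
      (1 + t) ^ (μ / 2) / ((1 + t) ^ (μ / 2 * p) * (1 + t) ^ (m * (p - 1))) := by
    rw [← Real.rpow_add hτ, ← Real.rpow_sub hτ]
    congr 1; ring
  have h2 : Real.exp (-t) * Real.exp (t * p) = Real.exp (t * (p - 1)) := by
    rw [← Real.exp_add]; ring_nf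
  rw [h1, ← h2]
  have := Real.exp_pos (-t)
  have := Real.exp_pos (t * p)
  field_simp

/-- The basic a priori bound: on its interval of existence, a solution forces the integral of
`(1 + t)^{-θ}` to be at most a multiple of `ε^{1-p}`. -/
theorem exists_existence_time_bound (i : Fin n) (hμ : 0 ≤ μ) (hδ : 0 ≤ delta μ ν) {R : ℝ}
    (hR : 0 < R) (hsupp₀ : tsupport u₀ ⊆ Metric.closedBall 0 R)
    (hsupp₁ : tsupport u₁ ⊆ Metric.closedBall 0 R) (h₀ : ∀ x, 0 ≤ u₀ x) (h₁ : ∀ x, 0 ≤ u₁ x)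
    (hpos : 0 < (1 + μ / 2) * weightedAverage i u₀ + weightedAverage i u₁) (hp : 1 < p) {θ : ℝ}
    (hθ : (p - 1) * (((n : ℝ) - 1) / 2 + μ / 2) ≤ θ) :
    ∃ D > 0, ∃ t₀ ≥ 0, ∀ (Φ : ℝ → ℝ), (∀ t, 0 ≤ t → HasDerivAt Φ ((1 + t) ^ (-θ)) t) →
      ∀ (ε : ℝ), 0 < ε → ∀ (T : EReal) (u : ℝ → EuclideanSpace ℝ (Fin n) → ℝ),
        IsSolution μ ν p ε u₀ u₁ T u → ∀ b ∈ timeIco T, t₀ ≤ b →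
          Φ b - Φ t₀ ≤ D * ε ^ (1 - p) := by
  obtain ⟨K, hK, hvol⟩ := exists_setIntegral_expWeight_le i hR
  set I := (1 + μ / 2) * weightedAverage i u₀ + weightedAverage i u₁ with hI
  set k := Real.exp (-(1 / 4)) * (8 ^ (-p) * K ^ (1 - p)) with hk
  have hkpos : 0 < k := by positivity
  have hp1 : 0 < p - 1 := by linarith
  -- D is what `integrated_superlinear_inequality` yields from G ≥ e^{-1/4} I ε. The starting time
  -- max(1, 4μ) is where G begins to bound V from below.
  refine ⟨(Real.exp (-(1 / 4)) * I) ^ (1 - p) / ((p - 1) * k), by positivity,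
    max 1 (4 * μ), le_max_of_le_left zero_le_one, ?_⟩
  intro Φ hΦ ε hε T u h b hb hb0
  set t₀ := max 1 (4 * μ) with ht₀
  have ht₀1 : 1 ≤ t₀ := le_max_left _ _
  have hIcc : Icc 0 b ⊆ timeIco T := fun t ht =>
    ⟨ht.1, lt_of_le_of_lt (EReal.coe_le_coe_iff.2 ht.2) hb.2⟩
  have hIoo : Ioo 0 b ⊆ timeIoo T := fun t ht => ⟨ht.1, (hIcc ⟨ht.1.le, ht.2.le⟩).2⟩
  have hzero : ∀ t ∈ Icc 0 b, ∀ x ∉ Metric.closedBall (0 : EuclideanSpace ℝ (Fin n)) (R + t),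
      u t x = 0 ∧ velocity u t x = 0 := fun t ht x hx =>
    h.eq_zero_of_lt_norm hμ hp hsupp₀ hsupp₁ (hIcc ht) (by simpa using hx)
  have hzero' : ∀ t ∈ Icc 0 b, ∀ x ∉ Metric.closedBall (0 : EuclideanSpace ℝ (Fin n)) (R + b),
      u t x = 0 ∧ velocity u t x = 0 := fun t ht x hx =>
    hzero t ht x fun hm => hx (Metric.closedBall_subset_closedBall (by linarith [ht.2]) hm)
  have hKc : IsCompact (Metric.closedBall (0 : EuclideanSpace ℝ (Fin n)) (R + b)) :=
    isCompact_closedBall _ _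
  have hω : ContinuousOn (fun q : ℝ × EuclideanSpace ℝ (Fin n) => expWeight i q.2)
      (Icc 0 b ×ˢ univ) := ((continuous_expWeight i).comp continuous_snd).continuousOn
  have hWc : ContinuousOn (fun t => weightedAverage i (u t)) (Icc 0 b) :=
    continuousOn_integral_of_compact_support (f := fun t x => u t x * expWeight i x) hKc
      ((h.continuousOn.mono (prod_mono hIcc le_rfl)).mul hω)
      fun t x ht hx => by simp [(hzero' t ht x hx).1]
  have hVc : ContinuousOn (fun t => weightedAverage i (velocity u t)) (Icc 0 b) :=
    continuousOn_integral_of_compact_support (f := fun t x => velocity u t x * expWeight i x) hKc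
      ((h.continuousOn_velocity.mono (prod_mono hIcc le_rfl)).mul hω)
      fun t x ht hx => by simp [(hzero' t ht x hx).2]
  have hW0 : weightedAverage i (u 0) = ε * weightedAverage i u₀ := by
    simp only [weightedAverage, h.initial_value, mul_assoc, integral_const_mul]
  have hV0 : weightedAverage i (velocity u 0) = ε * weightedAverage i u₁ := by
    simp only [weightedAverage, h.velocity_zero, mul_assoc, integral_const_mul]
  obtain ⟨G, G', hGc, hGd, hG0, hGV⟩ := damped_equation_growth
    (W := fun t => weightedAverage i (u t)) (V := fun t => weightedAverage i (velocity u t))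
    (N := fun t => weightedAverage i fun x => |velocity u t x| ^ p) hμ hδ hWc hVc
    (fun t ht => h.hasDerivAt_weightedAverage i isOpen_Ioo hIoo hKc
      (fun r hr x hx => (hzero' r (Ioo_subset_Icc_self hr) x hx).1) ht)
    (fun t ht => h.hasDerivAt_weightedAverage_velocity hp i isOpen_Ioo hIoo hKc
      (fun r hr x hx => hzero' r (Ioo_subset_Icc_self hr) x hx) ht)
    (fun t ht => weightedAverage_nonneg i fun x => by positivity)
    (by rw [hW0]; exact mul_nonneg hε.le (weightedAverage_nonneg i h₀))
    (by rw [hV0]; exact mul_nonneg hε.le (weightedAverage_nonneg i h₁))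
  have hstart : Real.exp (-(1 / 4)) * ((1 + μ / 2) * weightedAverage i (u 0) +
      weightedAverage i (velocity u 0)) = Real.exp (-(1 / 4)) * I * ε := by
    rw [hW0, hV0, hI]; ring
  simp only [hstart] at hG0
  have hg₀ : 0 < Real.exp (-(1 / 4)) * I * ε := by positivity
  have hsub : Icc t₀ b ⊆ Icc 0 b := Icc_subset_Icc (by linarith) le_rfl
  have hsub' : Ioo t₀ b ⊆ Ioo 0 b := Ioo_subset_Ioo (by linarith) le_rfl
  have hmain := integrated_superlinear_inequality (k := k) hb0 hp (hGc.mono hsub)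
    (fun t ht => (hGd t (hsub' ht)).1)
    (fun t ht => (hΦ t (hsub ht).1).continuousAt.continuousWithinAt)
    (fun t ht => hΦ t (hsub' ht).1.le) hg₀ (fun t ht => hG0 t (hsub ht)) (by
      intro t ht
      have ht0 : 0 ≤ t := (hsub' ht).1.le
      have htI : t ∈ Icc 0 b := Ioo_subset_Icc_self (hsub' ht)
      have hτ : 1 ≤ 1 + t := by linarith
      have hGt : 0 < G t := hg₀.trans_le (hG0 t htI)
      refine le_trans ?_ (hGd t (hsub' ht)).2
      set V := weightedAverage i (velocity u t) with hV
      set N := weightedAverage i (fun x => |velocity u t x| ^ p) with hN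
      set A := ∫ x in Metric.closedBall (0 : EuclideanSpace ℝ (Fin n)) (R + t), expWeight i x
      have hlow : Real.exp t * G t / (8 * (1 + t) ^ (μ / 2)) ≤ V := by
        rw [div_le_iff₀ (by positivity)]
        have := hGV t htI (ht₀1.trans ht.1.le) ((le_max_right _ _).trans ht.1.le)
        linarith
      have hVpos : 0 < V := lt_of_lt_of_le (by positivity) hlow
      have hjen := weightedAverage_rpow_le i hp (by linarith : 0 < R + t)
        (continuous_slice h.continuousOn_velocity (hIcc htI))
        (fun x hx => (hzero t htI x hx).2) hVpos
      have hNn : 0 ≤ N := weightedAverage_nonneg i fun x => by positivity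
      have hA : A ^ (p - 1) ≤ (K * (Real.exp t * (1 + t) ^ (((n : ℝ) - 1) / 2))) ^ (p - 1) :=
        Real.rpow_le_rpow (setIntegral_nonneg Metric.isClosed_closedBall.measurableSet
          fun x _ => (expWeight_pos i x).le) (hvol t ht0) hp1.le
      have hNlow : (Real.exp t * G t / (8 * (1 + t) ^ (μ / 2))) ^ p /
          (K * (Real.exp t * (1 + t) ^ (((n : ℝ) - 1) / 2))) ^ (p - 1) ≤ N := by
        rw [div_le_iff₀ (by positivity)]
        exact (Real.rpow_le_rpow (by positivity) hlow (by linarith)).trans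
          (hjen.trans (mul_le_mul_of_nonneg_left hA hNn))
      -- Enlarging the decay exponent only weakens the inequality, which leaves room to replace μ by
      -- σ.
      have hdec : (1 + t) ^ (-θ) ≤
          (1 + t) ^ (-((p - 1) * (((n : ℝ) - 1) / 2 + μ / 2))) :=
        Real.rpow_le_rpow_of_exponent_le hτ (by linarith)
      calc k * G t ^ p * (1 + t) ^ (-θ)
          ≤ k * G t ^ p * (1 + t) ^ (-((p - 1) * (((n : ℝ) - 1) / 2 + μ / 2))) :=
            mul_le_mul_of_nonneg_left hdec (by positivity)
        _ = Real.exp (-(1 / 4)) * (8 ^ (-p) * K ^ (1 - p) * G t ^ p *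
              (1 + t) ^ (-((p - 1) * (((n : ℝ) - 1) / 2 + μ / 2)))) := by rw [hk]; ring
        _ = Real.exp (-(1 / 4)) * (Real.exp (-t) * (1 + t) ^ (μ / 2) *
              ((Real.exp t * G t / (8 * (1 + t) ^ (μ / 2))) ^ p /
              (K * (Real.exp t * (1 + t) ^ (((n : ℝ) - 1) / 2))) ^ (p - 1))) := by
            rw [mul_rpow_weights ht0 hGt.le hK]
        _ ≤ Real.exp (-(1 / 4)) * (Real.exp (-t) * (1 + t) ^ (μ / 2) * N) := by gcongr
        _ = _ := by ring)
  rw [Real.mul_rpow (by positivity) hε.le] at hmain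
  rw [div_mul_eq_mul_div, le_div_iff₀ (by positivity)]
  linarith

/-- A bound on all existence times bounds the lifespan. -/
lemma lifespan_le {ε B : ℝ} (hB : 0 ≤ B)
    (h : ∀ (T : EReal) (u : ℝ → EuclideanSpace ℝ (Fin n) → ℝ), IsSolution μ ν p ε u₀ u₁ T u →
      ∀ b ∈ timeIco T, b ≤ B) (T : EReal) (u : ℝ → EuclideanSpace ℝ (Fin n) → ℝ) :
    lifespan μ ν p ε u₀ u₁ T u ≤ B := by
  refine sSup_le ?_
  rintro T' ⟨-, v, hv, -⟩
  by_contra! hlt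
  obtain ⟨b, hBb, hbT⟩ := EReal.lt_iff_exists_real_btwn.1 hlt
  have hBb' : B < b := EReal.coe_lt_coe_iff.1 hBb
  exact absurd (h T' v hv b ⟨hB.trans hBb'.le, hbT⟩) (not_le.2 hBb')

lemma le_mul_rpow_of_rpow_le {θ C q ε b : ℝ} (hθ : θ < 1) (hb : 0 ≤ b) (hC : 0 < C) (hε : 0 < ε)
    (h : (1 + b) ^ (1 - θ) ≤ C * ε ^ (-q)) :
    b ≤ C ^ (1 / (1 - θ)) * ε ^ (-(q / (1 - θ))) := by
  have hθ' : 0 < 1 - θ := by linarith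
  have h1 := Real.rpow_le_rpow (by positivity) h (by positivity : 0 ≤ 1 / (1 - θ))
  rw [← Real.rpow_mul (by linarith), mul_one_div_cancel hθ'.ne', Real.rpow_one,
    Real.mul_rpow hC.le (by positivity), ← Real.rpow_mul hε.le] at h1
  have h2 : -q * (1 / (1 - θ)) = -(q / (1 - θ)) := by ring
  rw [h2] at h1
  linarith

lemma one_le_rpow_neg {ε q : ℝ} (hε : 0 < ε) (hε1 : ε ≤ 1) (hq : 0 ≤ q) : 1 ≤ ε ^ (-q) :=
  Real.one_le_rpow_of_pos_of_le_one_of_nonpos hε hε1 (by linarith)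

/-- If δ < 1, then 1 - √δ ≥ 0. The differential inequality naturally carries μ, so this comparison
suffices to reach the exponents stated with σ. -/
lemma le_sigma (μ ν : ℝ) : μ ≤ sigma μ ν := by
  unfold sigma
  split_ifs with h
  · have : √(delta μ ν) ≤ 1 := by
      rw [Real.sqrt_le_one]
      exact h.le
    linarith
  · exact le_rfl

/-- Clearing denominators turns the Glassey condition into θ < 1. The convention ∞ covers m = 0,
where θ = 0. -/
lemma lt_glassey_iff {m : ℝ} (hm : 0 ≤ m) :
    (p : EReal) < glassey (m + 1) ↔ (p - 1) * (m / 2) < 1 := by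
  unfold glassey
  split_ifs with h
  · have : m = 0 := by linarith
    simp [this, EReal.coe_lt_top]
  · have hm' : 0 < m + 1 - 1 := by linarith
    rw [EReal.coe_lt_coe_iff, lt_div_iff₀ hm']
    constructor <;> intro h <;> linarith

lemma eq_glassey_imp {m : ℝ} (h : (p : EReal) = glassey (m + 1)) : (p - 1) * (m / 2) = 1 := by
  unfold glassey at h
  split_ifs at h with h1
  · exact absurd h (EReal.coe_ne_top p)
  · have hm' : m + 1 - 1 ≠ 0 := by intro h; apply h1; linarith
    rw [EReal.coe_eq_coe_iff, eq_div_iff hm'] at h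
    linarith

end

end ScaleInvariantWave

end

/-! ### Conclusion: the two lifespan bounds -/

open ScaleInvariantWave

theorem theorem1 (n : ℕ) (hn : 1 ≤ n) (μ ν : ℝ) (hμ : 0 ≤ μ)
    (hδ : 0 ≤ ScaleInvariantWave.delta μ ν)
    (R : ℝ) (hR : 0 < R) (u₀ u₁ : EuclideanSpace ℝ (Fin n) → ℝ)
    (hsupp₀ : tsupport u₀ ⊆ Metric.closedBall 0 R)
    (hsupp₁ : tsupport u₁ ⊆ Metric.closedBall 0 R)
    (hne : ¬ (u₀ = 0 ∧ u₁ = 0))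
    (hsign_ge : 1 ≤ ScaleInvariantWave.delta μ ν → (∀ x, 0 ≤ u₀ x) ∧ ∀ x, 0 ≤ u₁ x)
    (hsign_lt : ScaleInvariantWave.delta μ ν < 1 → u₀ = 0 ∧ ∀ x, 0 ≤ u₁ x)
    (p : ℝ) (hp : 1 < p)
    (hpG : (p : EReal) ≤ ScaleInvariantWave.glassey (n + ScaleInvariantWave.sigma μ ν)) :
    ∃ ε₀ > (0 : ℝ), ∃ C > (0 : ℝ), ∀ ε : ℝ, 0 < ε → ε ≤ ε₀ →
      ∀ (T : EReal) (u : ℝ → EuclideanSpace ℝ (Fin n) → ℝ),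
        ScaleInvariantWave.IsSolution μ ν p ε u₀ u₁ T u →
          ScaleInvariantWave.BlowsUpInFiniteTime μ ν p ε u₀ u₁ T u ∧
          ((p : EReal) < ScaleInvariantWave.glassey (n + ScaleInvariantWave.sigma μ ν) →
            ScaleInvariantWave.lifespan μ ν p ε u₀ u₁ T u ≤
              ((C * ε ^ (-(1 / (p - 1) - (n + ScaleInvariantWave.sigma μ ν - 1) / 2)⁻¹) : ℝ) :
                EReal)) ∧
          ((p : EReal) = ScaleInvariantWave.glassey (n + ScaleInvariantWave.sigma μ ν) →
            ScaleInvariantWave.lifespan μ ν p ε u₀ u₁ T u ≤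
              ((Real.exp (C * ε ^ (-(p - 1))) : ℝ) : EReal)) := by
  have hp1 : 0 < p - 1 := by linarith
  have h₀₁ : (∀ x, 0 ≤ u₀ x) ∧ ∀ x, 0 ≤ u₁ x := by
    rcases lt_or_ge (delta μ ν) 1 with h | h
    · exact ⟨fun x => by simp [(hsign_lt h).1], (hsign_lt h).2⟩
    · exact hsign_ge h
  -- The existence of a solution forces the data to be continuous.
  by_cases hcont : Continuous u₀ ∧ Continuous u₁
  swap
  · exact ⟨1, one_pos, 1, one_pos, fun ε hε _ T u h => absurd (h.continuous_data hε) hcont⟩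
  set i : Fin n := ⟨0, hn⟩
  have hpos : 0 < (1 + μ / 2) * weightedAverage i u₀ + weightedAverage i u₁ := by
    have a0 := weightedAverage_nonneg i h₀₁.1
    have a1 := weightedAverage_nonneg i h₀₁.2
    by_cases hu₀ : u₀ = 0
    · have := weightedAverage_pos i hcont.2 hsupp₁ h₀₁.2 fun hu₁ => hne ⟨hu₀, hu₁⟩
      positivity
    · have := weightedAverage_pos i hcont.1 hsupp₀ h₀₁.1 hu₀
      positivity
  have hσ := le_sigma μ ν
  have hn' : (1 : ℝ) ≤ n := by exact_mod_cast hn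
  set m : ℝ := n - 1 + sigma μ ν with hm
  have hm0 : 0 ≤ m := by linarith
  have hmσ : (n : ℝ) + sigma μ ν = m + 1 := by rw [hm]; ring
  rw [hmσ] at hpG
  simp only [hmσ, add_sub_cancel_right]
  -- θ < 1 in the subcritical case and θ = 1 in the critical one.
  set θ := (p - 1) * (m / 2) with hθ
  obtain ⟨D, hD, t₀, ht₀, hbound⟩ := exists_existence_time_bound (ν := ν) i hμ hδ hR hsupp₀ hsupp₁
    h₀₁.1 h₀₁.2 hpos hp (θ := θ) (mul_le_mul_of_nonneg_left (by linarith) hp1.le)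
  have hlin : ∀ t : ℝ, HasDerivAt (fun s : ℝ => 1 + s) 1 t := fun t => by
    simpa using (hasDerivAt_id t).const_add 1
  rcases hpG.lt_or_eq with hlt | heq
  · have hθ1 : θ < 1 := (lt_glassey_iff hm0).1 hlt
    have hθ' : 0 < 1 - θ := by linarith
    -- The second summand covers the times before t₀; it is absorbed because ε ≤ 1 gives ε^{-(p-1)}
    -- ≥ 1.
    set C := (1 - θ) * D + (1 + t₀) ^ (1 - θ) with hC
    have hCpos : 0 < C := by positivity
    have hexp : (1 / (p - 1) - m / 2)⁻¹ = (p - 1) / (1 - θ) := by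
      have : 1 / (p - 1) - m / 2 = (1 - θ) / (p - 1) := by
        rw [hθ]; field_simp
      rw [this, inv_div]
    refine ⟨1, one_pos, C ^ (1 / (1 - θ)), by positivity, fun ε hε hε1 T u _ => ?_⟩
    have hle := lifespan_le (μ := μ) (ν := ν) (p := p) (u₀ := u₀) (u₁ := u₁) (ε := ε)
      (B := C ^ (1 / (1 - θ)) * ε ^ (-(1 / (p - 1) - m / 2)⁻¹)) (by positivity) (by
        intro T v hv b hb
        rw [hexp]
        refine le_mul_rpow_of_rpow_le hθ1 hb.1 hCpos hε ?_
        have hone := one_le_rpow_neg hε hε1 hp1.le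
        have hb0 := hb.1
        have h1 : (1 + b) ^ (1 - θ) ≤ (1 - θ) * D * ε ^ (-(p - 1)) + (1 + t₀) ^ (1 - θ) := by
          rcases le_total b t₀ with hbt | hbt
          · have : (1 + b) ^ (1 - θ) ≤ (1 + t₀) ^ (1 - θ) :=
              Real.rpow_le_rpow (by linarith) (by linarith) hθ'.le
            have : 0 ≤ (1 - θ) * D * ε ^ (-(p - 1)) := by positivity
            linarith
          · have h2 := hbound (fun s => (1 + s) ^ (1 - θ) / (1 - θ)) (by
              intro t ht
              refine (((hlin t).rpow_const (p := 1 - θ)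
                (Or.inl (by positivity))).div_const (1 - θ)).congr_deriv ?_
              rw [one_mul, mul_div_cancel_left₀ _ hθ'.ne']
              congr 1; ring) ε hε T v hv b hb hbt
            rw [← sub_div, div_le_iff₀ hθ', show (1 : ℝ) - p = -(p - 1) by ring] at h2
            linarith
        have h3 : (1 + t₀) ^ (1 - θ) * 1 ≤ (1 + t₀) ^ (1 - θ) * ε ^ (-(p - 1)) :=
          mul_le_mul_of_nonneg_left hone (by positivity)
        rw [hC, add_mul]
        linarith) T u
    exact ⟨hle.trans_lt (EReal.coe_lt_top _), fun _ => hle, fun h => absurd h hlt.ne⟩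
  · have hθ1 : θ = 1 := eq_glassey_imp heq
    set C := D + Real.log (1 + t₀) with hC
    have hlog : 0 ≤ Real.log (1 + t₀) := Real.log_nonneg (by linarith)
    refine ⟨1, one_pos, C, by positivity, fun ε hε hε1 T u _ => ?_⟩
    have hle := lifespan_le (μ := μ) (ν := ν) (p := p) (u₀ := u₀) (u₁ := u₁) (ε := ε)
      (B := Real.exp (C * ε ^ (-(p - 1)))) (by positivity) (by
        intro T v hv b hb
        have hb0 := hb.1
        have hone := one_le_rpow_neg hε hε1 hp1.le
        have h1 : Real.log (1 + b) ≤ D * ε ^ (-(p - 1)) + Real.log (1 + t₀) := by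
          rcases le_total b t₀ with hbt | hbt
          · have : Real.log (1 + b) ≤ Real.log (1 + t₀) :=
              Real.log_le_log (by linarith) (by linarith)
            have : 0 ≤ D * ε ^ (-(p - 1)) := by positivity
            linarith
          -- At θ = 1 the primitive of (1+t)^{-θ} is logarithmic, which produces the exponential
          -- lifespan.
          · have h2 := hbound (fun s => Real.log (1 + s)) (by
              intro t ht
              refine ((hlin t).log (by positivity)).congr_deriv ?_
              rw [hθ1, Real.rpow_neg_one, one_div]) ε hε T v hv b hb hbt
            rw [show (1 : ℝ) - p = -(p - 1) by ring] at h2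
            linarith
        have h3 : Real.log (1 + t₀) * 1 ≤ Real.log (1 + t₀) * ε ^ (-(p - 1)) :=
          mul_le_mul_of_nonneg_left hone hlog
        have h4 : Real.log (1 + b) ≤ C * ε ^ (-(p - 1)) := by
          rw [hC, add_mul]; linarith
        have h5 := (Real.log_le_iff_le_exp (by linarith)).1 h4
        linarith) T u
    exact ⟨hle.trans_lt (EReal.coe_lt_top _), fun h => absurd heq h.ne, fun _ => hle⟩
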